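/- Let $\mathbb{T}\subset\mathbb{R}$ be a time scale (a nonempty closed set) with $a=\min\mathbb{T}$, $b=\max\mathbb{T}$ and $\mathbb{T}\cap(a,b)\neq\emptyset$. Let $\sigma,\rho$ be its forward and backward jump operators. For a closed subset $X\subseteq\mathbb{T}$ let $X^{\kappa}$ be $X$ without its maximum if the maximum is left-scattered in $X$ (otherwise $X^\kappa=X$), let $X_{\kappa}$ be $X$ without its minimum if the minimum is right-scattered in $X$ (otherwise $X_\kappa=X$), and put $X^{\kappa^2}=(X^\kappa)^\kappa$, $X_{\kappa^2}=(X_\kappa)_\kappa$, $X^{\kappa}_{\kappa}=X^\kappa\cap X_\kappa$, $X^{\kappa^2}_{\kappa^2}=X^{\kappa^2}\cap X_{\kappa^2}$. Let $C^1_\diamond$ be the class of functions $y:\mathbb{T}\to\mathbb{R}$ whose delta derivative $y^\Delta$ exists and is continuous on $\mathbb{T}^\kappa$ and whose nabla derivative $y^\nabla$ exists and is continuous on $\mathbb{T}_\kappa$, and put $\|y\|_{1,\infty}=\|y\circ\sigma\|_\infty+\|y\circ\rho\|_\infty+\|y^\Delta\|_\infty+\|y^\nabla\|_\infty$, where $\|f\|_\infty=\sup_{t\in\mathbb{T}^\kappa_\kappa}|f(t)|$.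 For $f:X\to\mathbb{R}$ let $\overline f:[\min X,\max X]\to\mathbb{R}$ be the extension of $f$ that is affine on each gap of $X$, and let $D\overline f(t)(u)=\lim_{h\to0^+}\frac{\overline f(t+hu)-\overline f(t)}{h}$, which presupposes that $t+hu\in[\min X,\max X]$ for all small $h>0$. Fix a real $u\neq0$. Put $(y\circ\xi_u)(t)=u\,y(\sigma(t))$ and $\int_a^b f\,d_ut=u\int_a^b f\,\Delta t$ if $u>0$, and $(y\circ\xi_u)(t)=u\,y(\rho(t))$ and $\int_a^b f\,d_ut=u\int_a^b f\,\nabla t$ if $u<0$. Let $L:\mathbb{T}\times\mathbb{R}^2\to\mathbb{R}$ be continuous with partial derivatives $\partial_2L,\partial_3L$ that exist and are continuous on $\mathbb{T}\times\mathbb{R}^2$. Let $\alpha,\beta\in\mathbb{R}$ and let $y\in C^1_\diamond$ be a weak local minimizer of $$\mathcal{L}(z)=\int_a^b L\bigl(t,(z\circ\xi_u)(t),D\overline z(t)(u)\bigr)\,d_ut,\qquad z(a)=\alpha,\quad z(b)=\beta,$$ that is, $y(a)=\alpha$, $y(b)=\beta$, and there is $\delta>0$ with $\mathcal{L}(y)\le\mathcal{L}(z)$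 for all $z\in C^1_\diamond$ with $z(a)=\alpha$, $z(b)=\beta$ and $\|z-y\|_{1,\infty}<\delta$. Put $F(t)=\partial_3L\bigl(t,(y\circ\xi_u)(t),D\overline y(t)(u)\bigr)$, considered on $\mathbb{T}^\kappa$ if $u>0$ and on $\mathbb{T}_\kappa$ if $u<0$. Then, at every $t\in\mathbb{T}^{\kappa^2}_{\kappa^2}$ with $\sigma(t)<b$ if $u>0$, respectively $\rho(t)>a$ if $u<0$, the directional derivative $D\overline F(t)(u)$ exists and $$D\overline F(t)(u)=u\cdot\partial_2L\bigl(t,(y\circ\xi_u)(t),D\overline y(t)(u)\bigr).$$ This unifies the delta and the nabla Euler-Lagrange equations: if $u>0$, then the function $s\mapsto\partial_3L(s,u\,y(\sigma(s)),u\,y^\Delta(s))$ on $\mathbb{T}^\kappa$ has at $t$ the delta derivative $\partial_2L(t,u\,y(\sigma(t)),u\,y^\Delta(t))$ for every $t\in\mathbb{T}^{\kappa^2}$ with $\sigma(t)<b$ or $t=b$; if $u<0$, then the function $s\mapsto\partial_3L(s,u\,y(\rho(s)),u\,y^\nabla(s))$ on $\mathbb{T}_\kappa$ has at $t$ the nabla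 derivative $\partial_2L(t,u\,y(\rho(t)),u\,y^\nabla(t))$ for every $t\in\mathbb{T}_{\kappa^2}$ with $\rho(t)>a$ or $t=a$. -/

import Mathlib

open Set Filter Topology MeasureTheory

namespace TimeScale

noncomputable section

/-! Calculus on a compact time scale `X ⊆ ℝ` (a nonempty compact set).  Functions on `X` are
represented by functions `ℝ → ℝ`; only their values on `X` are used. -/

open Classical in
/-- Forward jump operator `σ(t) = inf {s ∈ X : s > t}`, with `σ (max X) = max X`. -/
def sigma (X : Set ℝ) (t : ℝ) : ℝ :=
  if (X ∩ Ioi t).Nonempty then sInf (X ∩ Ioi t) else t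

open Classical in
/-- Backward jump operator `ρ(t) = sup {s ∈ X : s < t}`, with `ρ (min X) = min X`. -/
def rho (X : Set ℝ) (t : ℝ) : ℝ :=
  if (X ∩ Iio t).Nonempty then sSup (X ∩ Iio t) else t

/-- `X^κ = X \ (ρ(b), b]` with `b = max X`. -/
def kappaUp (X : Set ℝ) : Set ℝ := X \ Ioc (rho X (sSup X)) (sSup X)

/-- `X_κ = X \ [a, σ(a))` with `a = min X`. -/
def kappaDown (X : Set ℝ) : Set ℝ := X \ Ico (sInf X) (sigma X (sInf X))

/-- `d` is the delta (Hilger) derivative of `f` at `t ∈ X^κ`. -/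
def HasDeltaDeriv (X : Set ℝ) (f : ℝ → ℝ) (t d : ℝ) : Prop :=
  t ∈ kappaUp X ∧ ∀ ε > 0, ∃ δ > 0, ∀ s ∈ X, |s - t| < δ →
    |f (sigma X t) - f s - d * (sigma X t - s)| ≤ ε * |sigma X t - s|

/-- `d` is the nabla derivative of `f` at `t ∈ X_κ`. -/
def HasNablaDeriv (X : Set ℝ) (f : ℝ → ℝ) (t d : ℝ) : Prop :=
  t ∈ kappaDown X ∧ ∀ ε > 0, ∃ δ > 0, ∀ s ∈ X, |s - t| < δ →
    |f (rho X t) - f s - d * (rho X t - s)| ≤ ε * |rho X t - s|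

open Classical in
/-- The delta derivative `f^Δ(t)` (the value is `0` where it does not exist). -/
def deltaDeriv (X : Set ℝ) (f : ℝ → ℝ) (t : ℝ) : ℝ :=
  if h : ∃ d, HasDeltaDeriv X f t d then h.choose else 0

open Classical in
/-- The nabla derivative `f^∇(t)` (the value is `0` where it does not exist). -/
def nablaDeriv (X : Set ℝ) (f : ℝ → ℝ) (t : ℝ) : ℝ :=
  if h : ∃ d, HasNablaDeriv X f t d then h.choose else 0

/-- The class `C¹_◇`: `f^Δ` exists and is continuous on `X^κ`, and `f^∇` exists and is
continuous on `X_κ`. -/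
structure C1Diamond (X : Set ℝ) (f : ℝ → ℝ) : Prop where
  delta_exists : ∀ t ∈ kappaUp X, ∃ d, HasDeltaDeriv X f t d
  delta_cont : ContinuousOn (deltaDeriv X f) (kappaUp X)
  nabla_exists : ∀ t ∈ kappaDown X, ∃ d, HasNablaDeriv X f t d
  nabla_cont : ContinuousOn (nablaDeriv X f) (kappaDown X)

/-- `‖f‖_∞ = sup {|f(t)| : t ∈ X^κ ∩ X_κ}`. -/
def supNorm (X : Set ℝ) (f : ℝ → ℝ) : ℝ :=
  ⨆ t : ↥(kappaUp X ∩ kappaDown X), |f t|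

/-- `‖f‖_{1,∞} = ‖f^σ‖_∞ + ‖f^ρ‖_∞ + ‖f^Δ‖_∞ + ‖f^∇‖_∞`. -/
def norm1 (X : Set ℝ) (f : ℝ → ℝ) : ℝ :=
  supNorm X (fun t => f (sigma X t)) + supNorm X (fun t => f (rho X t)) +
    supNorm X (deltaDeriv X f) + supNorm X (nablaDeriv X f)

/-- The delta integral over `[min X, max X]`, that is, the integral over `[min X, max X)` against
the Lebesgue delta-measure (the image of Lebesgue measure under `t ↦ max {s ∈ X : s ≤ t}`): it is
the Lebesgue integral of the function equal to `f` on `X` and to `f s` on each gap `(s, σ(s))`. -/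
def deltaIntegral (X : Set ℝ) (f : ℝ → ℝ) : ℝ :=
  ∫ t in (sInf X)..(sSup X), f (sSup (X ∩ Iic t))

/-- The nabla integral over `[min X, max X]`, that is, the integral over `(min X, max X]` against
the Lebesgue nabla-measure: it is the Lebesgue integral of the function equal to `f` on `X` and
to `f s` on each gap `(ρ(s), s)`. -/
def nablaIntegral (X : Set ℝ) (f : ℝ → ℝ) : ℝ :=
  ∫ t in (sInf X)..(sSup X), f (sInf (X ∩ Ici t))

open Classical in
/-- `∫ f d_u t`: `u ∫ f Δt` if `u ≥ 0`, and `u ∫ f ∇t` if `u ≤ 0`. -/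
def dirIntegral (X : Set ℝ) (u : ℝ) (f : ℝ → ℝ) : ℝ :=
  if 0 ≤ u then u * deltaIntegral X f else u * nablaIntegral X f

open Classical in
/-- `y ∘ ξ_u`: `u (y ∘ σ)` if `u ≥ 0`, and `u (y ∘ ρ)` if `u ≤ 0`. -/
def xiComp (X : Set ℝ) (u : ℝ) (y : ℝ → ℝ) (t : ℝ) : ℝ :=
  if 0 ≤ u then u * y (sigma X t) else u * y (rho X t)

open Classical in
/-- The extension `f̄` of `f : X → ℝ` to `[min X, max X]`: it is `f` on `X` and affine on each gap
`(s, σ(s))`; for `t` in that gap, `s = max {r ∈ X : r < t}`. -/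
def ext (X : Set ℝ) (f : ℝ → ℝ) (t : ℝ) : ℝ :=
  if t ∈ X then f t
  else
    let s := sSup (X ∩ Iio t)
    f s + (f (sigma X s) - f s) / (sigma X s - s) * (t - s)

/-- `d = D f̄(t)(u)`, the derivative from the right of `f̄ : [min X, max X] → ℝ` at `t` in the
direction `u`.  The middle clause says that `f̄ (t + h u)` is defined for all small `h > 0`. -/
def HasDirDeriv (X : Set ℝ) (f : ℝ → ℝ) (t u d : ℝ) : Prop :=
  t ∈ Icc (sInf X) (sSup X) ∧
  (∀ᶠ h in 𝓝[>] (0 : ℝ), t + h * u ∈ Icc (sInf X) (sSup X)) ∧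
  Tendsto (fun h : ℝ => (ext X f (t + h * u) - ext X f t) / h) (𝓝[>] 0) (𝓝 d)

open Classical in
/-- The directional derivative `D f̄(t)(u)` (the value is `0` where it does not exist). -/
def dirDeriv (X : Set ℝ) (f : ℝ → ℝ) (t u : ℝ) : ℝ :=
  if h : ∃ d, HasDirDeriv X f t u d then h.choose else 0

/-- `∂₂L`. -/
def partial2 (L : ℝ → ℝ → ℝ → ℝ) (t x v : ℝ) : ℝ := deriv (fun z => L t z v) x

/-- `∂₃L`. -/
def partial3 (L : ℝ → ℝ → ℝ → ℝ) (t x v : ℝ) : ℝ := deriv (fun w => L t x w) v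

/-- The regularity of the Lagrangian `L : X × ℝ² → ℝ`: `L` is continuous, and `∂₂L` and `∂₃L`
exist and are continuous on `X × ℝ²`. No differentiability in `t` is required. -/
structure SmoothLagrangian (X : Set ℝ) (L : ℝ → ℝ → ℝ → ℝ) : Prop where
  cont : ContinuousOn (fun p : ℝ × ℝ × ℝ => L p.1 p.2.1 p.2.2) (X ×ˢ univ)
  diff2 : ∀ t ∈ X, ∀ x v : ℝ, DifferentiableAt ℝ (fun z => L t z v) x
  diff3 : ∀ t ∈ X, ∀ x v : ℝ, DifferentiableAt ℝ (fun w => L t x w) v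
  cont2 : ContinuousOn (fun p : ℝ × ℝ × ℝ => partial2 L p.1 p.2.1 p.2.2) (X ×ˢ univ)
  cont3 : ContinuousOn (fun p : ℝ × ℝ × ℝ => partial3 L p.1 p.2.1 p.2.2) (X ×ˢ univ)

/-- The functional `∫_a^b L(t, (y ∘ ξ_u)(t), D ȳ(t)(u)) d_u t`. -/
def functional (X : Set ℝ) (L : ℝ → ℝ → ℝ → ℝ) (u : ℝ) (y : ℝ → ℝ) : ℝ :=
  dirIntegral X u (fun t => L t (xiComp X u y t) (dirDeriv X y t u))

/-- Admissible functions: `y ∈ C¹_◇` with `y(a) = α` and `y(b) = β`. -/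
def Admissible (X : Set ℝ) (α β : ℝ) (y : ℝ → ℝ) : Prop :=
  C1Diamond X y ∧ y (sInf X) = α ∧ y (sSup X) = β

/-- `y` is a weak local minimizer of the functional under the boundary conditions. -/
def IsWeakLocalMin (X : Set ℝ) (L : ℝ → ℝ → ℝ → ℝ) (u α β : ℝ) (y : ℝ → ℝ) : Prop :=
  Admissible X α β y ∧ ∃ δ > 0, ∀ z : ℝ → ℝ, Admissible X α β z →
    norm1 X (fun t => z t - y t) < δ → functional X L u y ≤ functional X L u z

open Classical in
/-- The time scale on which `t ↦ ∂₃L(t, (y ∘ ξ_u)(t), D ȳ(t)(u))` lives: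
`X^κ` if `u ≥ 0`, and `X_κ` otherwise. -/
def kappaDir (X : Set ℝ) (u : ℝ) : Set ℝ :=
  if 0 ≤ u then kappaUp X else kappaDown X

end

end TimeScale

/-! For `u > 0` the functional is a delta functional with integrand `u * L t (u x) (u v)`. For `u <
0` the reflection `t ↦ -t`, `y ↦ -y(-·)` turns the nabla functional on `T` into a delta functional
on `-T`. Everything therefore rests on the delta Euler-Lagrange equation,
`IsDeltaMin.hasDeltaDeriv`.

That equation comes from the classical argument. Vary `y` along the primitive `η` of a function `k`
with `∫ k = 0`; integrating by parts by Fubini (`integral_mul_primitive_sigma`), the first variation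
says that `F - P` is orthogonal to every such `k`, where `F` is `∂₃L` along `y` and `P` is the
primitive of `∂₂L` along `y`. Hence `F = c + P` on `X^κ` (`duBoisReymond`), and this is
differentiated.

The obstacle is that variations must lie in `C¹_◇`, so `η^∇ = k ∘ ρ` has to be continuous as well as
`η^Δ = k`. At a left-scattered, right-dense point `t` this forces `k (ρ t) = k t`, which leaves the
smaller class `IsTestFunction`. The class is still rich enough: the gaps that impose a condition are
pairwise disjoint closed intervals, and Urysohn functions constant on each of them exist because the
saturated open sets form a normal topology (`exists_continuous_const_on_intervals`). These functions
approximate indicators of enough initial segments to make the primitive of an orthogonal function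
vanish.

Delta integrals are handled as Lebesgue integrals of `p ∘ floor X`. Integrands involve `y ∘ σ`,
which need not be continuous at right-scattered points, hence the class `IsRegular`. Finally `D
f̄(t)(u)` equals `u f^Δ(t)` or `u f^∇(t)` according to the sign of `u`. The condition `σ t < b ∨ t =
b` makes the jump operators of `T^κ` and `T` agree at `t` (`sigma_kappaUp`). -/

namespace TimeScale

/-! ### Jump operators -/

theorem le_sigma (X : Set ℝ) (t : ℝ) : t ≤ sigma X t := by
  unfold sigma
  split_ifs with h
  · exact le_csInf h fun x hx => le_of_lt hx.2
  · exact le_rfl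

theorem sigma_le {X : Set ℝ} {t s : ℝ} (hs : s ∈ X) (hts : t < s) : sigma X t ≤ s := by
  have h : (X ∩ Ioi t).Nonempty := ⟨s, hs, hts⟩
  rw [sigma, if_pos h]
  exact csInf_le ⟨t, fun x hx => le_of_lt hx.2⟩ ⟨hs, hts⟩

theorem sigma_mem {X : Set ℝ} (hX : IsClosed X) {t : ℝ} (ht : t ∈ X) : sigma X t ∈ X := by
  unfold sigma
  split_ifs with h
  · have := csInf_mem_closure h ⟨t, fun x hx => le_of_lt hx.2⟩
    exact hX.closure_subset_iff.2 inter_subset_left this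
  · exact ht

theorem le_of_lt_sigma {X : Set ℝ} {t s : ℝ} (hs : s ∈ X) (h : s < sigma X t) : s ≤ t := by
  by_contra hc
  exact absurd (sigma_le hs (not_le.1 hc)) (not_le.2 h)

theorem exists_lt_of_sigma_lt {X : Set ℝ} {t z : ℝ} (h : (X ∩ Ioi t).Nonempty)
    (hz : sigma X t < z) : ∃ s ∈ X, t < s ∧ s < z := by
  rw [sigma, if_pos h] at hz
  obtain ⟨s, hs, hsz⟩ := exists_lt_of_csInf_lt h hz
  exact ⟨s, hs.1, hs.2, hsz⟩

theorem exists_lt_of_sigma_eq {X : Set ℝ} {b t z : ℝ} (hb : b ∈ X) (htb : t < b)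
    (h : sigma X t = t) (hz : t < z) : ∃ s ∈ X, t < s ∧ s < z :=
  exists_lt_of_sigma_lt ⟨b, hb, htb⟩ (h.symm ▸ hz)

theorem sigma_of_isGreatest {X : Set ℝ} {b : ℝ} (hb : IsGreatest X b) : sigma X b = b := by
  rw [sigma, if_neg]
  rintro ⟨x, hx, hbx⟩
  exact absurd (hb.2 hx) (not_le.2 hbx)

theorem sigma_mono (X : Set ℝ) : Monotone (sigma X) := by
  intro s t hst
  rcases hst.eq_or_lt with rfl | hst
  · exact le_rfl
  by_cases h : (X ∩ Ioi t).Nonempty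
  · obtain ⟨x, hx⟩ := id h
    rw [sigma, sigma, if_pos h, if_pos ⟨x, hx.1, hst.trans hx.2⟩]
    exact csInf_le_csInf ⟨s, fun x hx => le_of_lt hx.2⟩ h
      fun x hx => ⟨hx.1, hst.trans hx.2⟩
  · rw [sigma, sigma, if_neg h]
    split_ifs with h'
    · obtain ⟨x, hx⟩ := id h'
      refine (csInf_le ⟨s, fun x hx => le_of_lt hx.2⟩ hx).trans ?_
      by_contra hc
      exact h ⟨x, hx.1, not_le.1 hc⟩
    · exact hst.le

/-- Reflection respects the default values too, so no hypothesis on `X` or `t` is needed. Statements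
about `ρ` and `X_κ` are deduced from those about `σ` and `X^κ` through this identity. -/
theorem sigma_neg (X : Set ℝ) (t : ℝ) : sigma (-X) (-t) = -rho X t := by
  have h : -X ∩ Ioi (-t) = -(X ∩ Iio t) := by
    ext x; simp
  unfold sigma rho
  rw [h, Real.sInf_neg, Set.nonempty_neg]
  split_ifs <;> rfl

theorem rho_neg (X : Set ℝ) (t : ℝ) : rho (-X) (-t) = -sigma X t := by
  have := sigma_neg (-X) (-t)
  rw [neg_neg, neg_neg] at this
  linarith

theorem rho_eq (X : Set ℝ) (t : ℝ) : rho X t = -sigma (-X) (-t) := by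
  rw [sigma_neg, neg_neg]

theorem rho_le (X : Set ℝ) (t : ℝ) : rho X t ≤ t := by
  rw [rho_eq]; linarith [le_sigma (-X) (-t)]

theorem le_rho {X : Set ℝ} {t s : ℝ} (hs : s ∈ X) (hts : s < t) : s ≤ rho X t := by
  rw [rho_eq]
  have : sigma (-X) (-t) ≤ -s := sigma_le (by simpa using hs) (by linarith)
  linarith

theorem rho_mem {X : Set ℝ} (hX : IsClosed X) {t : ℝ} (ht : t ∈ X) : rho X t ∈ X := by
  rw [rho_eq]
  exact sigma_mem (X := -X) hX.neg (by simpa using ht)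

theorem ge_of_rho_lt {X : Set ℝ} {t s : ℝ} (hs : s ∈ X) (h : rho X t < s) : t ≤ s := by
  by_contra hc
  exact absurd (le_rho hs (not_le.1 hc)) (not_le.2 h)

theorem isGreatest_neg {X : Set ℝ} {a : ℝ} (ha : IsLeast X a) : IsGreatest (-X) (-a) :=
  ⟨by simpa using ha.1, fun x hx => by have := ha.2 hx; linarith⟩

theorem isLeast_neg {X : Set ℝ} {b : ℝ} (hb : IsGreatest X b) : IsLeast (-X) (-b) :=
  ⟨by simpa using hb.1, fun x hx => by have := hb.2 hx; linarith⟩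

theorem exists_lt_of_rho_eq {X : Set ℝ} {a t z : ℝ} (ha : a ∈ X) (hta : a < t)
    (h : rho X t = t) (hz : z < t) : ∃ s ∈ X, z < s ∧ s < t := by
  rw [rho_eq] at h
  obtain ⟨s, hs, h1, h2⟩ := exists_lt_of_sigma_eq (X := -X) (b := -a) (t := -t) (z := -z)
    (by simpa using ha) (by linarith) (by linarith) (by linarith)
  exact ⟨-s, hs, by linarith, by linarith⟩

theorem mem_kappaUp {X : Set ℝ} {b t : ℝ} (hb : IsGreatest X b) :
    t ∈ kappaUp X ↔ t ∈ X ∧ t ≤ rho X b := by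
  unfold kappaUp
  rw [hb.csSup_eq]
  constructor
  · rintro ⟨h1, h2⟩
    refine ⟨h1, ?_⟩
    by_contra hc
    exact h2 ⟨not_le.1 hc, hb.2 h1⟩
  · rintro ⟨h1, h2⟩
    exact ⟨h1, fun hc => absurd h2 (not_le.2 hc.1)⟩

theorem kappaUp_neg (X : Set ℝ) : kappaUp (-X) = -kappaDown X := by
  ext x
  unfold kappaUp kappaDown
  rw [Real.sSup_neg, rho_neg]
  simp only [Set.mem_sdiff, Set.mem_neg, mem_Ioc, mem_Ico]
  constructor
  · rintro ⟨h1, h2⟩; exact ⟨h1, fun h => h2 ⟨by linarith [h.2], by linarith [h.1]⟩⟩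
  · rintro ⟨h1, h2⟩; exact ⟨h1, fun h => h2 ⟨by linarith [h.2], by linarith [h.1]⟩⟩

theorem kappaDown_neg (X : Set ℝ) : kappaDown (-X) = -kappaUp X := by
  rw [← neg_neg (kappaDown (-X)), ← kappaUp_neg, neg_neg]

theorem mem_kappaDown {X : Set ℝ} {a t : ℝ} (ha : IsLeast X a) :
    t ∈ kappaDown X ↔ t ∈ X ∧ sigma X a ≤ t := by
  have := mem_kappaUp (t := -t) (isGreatest_neg ha)
  rw [kappaUp_neg, rho_neg] at this
  simpa using this

theorem kappaUp_eq {X : Set ℝ} {b : ℝ} (hb : IsGreatest X b) :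
    kappaUp X = X ∩ Iic (rho X b) := by
  ext t; exact mem_kappaUp hb

theorem isClosed_kappaUp {X : Set ℝ} {b : ℝ} (hX : IsClosed X) (hb : IsGreatest X b) :
    IsClosed (kappaUp X) := by
  rw [kappaUp_eq hb]; exact hX.inter isClosed_Iic

theorem isGreatest_kappaUp {X : Set ℝ} {b : ℝ} (hX : IsClosed X) (hb : IsGreatest X b) :
    IsGreatest (kappaUp X) (rho X b) :=
  ⟨(mem_kappaUp hb).2 ⟨rho_mem hX hb.1, le_rfl⟩, fun _ hx => ((mem_kappaUp hb).1 hx).2⟩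

theorem mem_kappaUp_of_lt {X : Set ℝ} {b t : ℝ} (hb : IsGreatest X b) (ht : t ∈ X) (h : t < b) :
    t ∈ kappaUp X :=
  (mem_kappaUp hb).2 ⟨ht, le_rho ht h⟩

theorem isLeast_kappaUp {X : Set ℝ} {a b : ℝ} (ha : IsLeast X a) (hb : IsGreatest X b)
    (hab : a < b) : IsLeast (kappaUp X) a :=
  ⟨mem_kappaUp_of_lt hb ha.1 hab, fun _ hx => ha.2 ((mem_kappaUp hb).1 hx).1⟩

theorem rho_eq_of_mem_kappaUp {X : Set ℝ} {b : ℝ} (hb : IsGreatest X b) (h : b ∈ kappaUp X) :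
    rho X b = b :=
  le_antisymm (rho_le X b) ((mem_kappaUp hb).1 h).2

/-- On `X^κ` the forward jump operator is that of `X`, except at the point jumping to `max X`. -/
theorem sigma_kappaUp {X : Set ℝ} {b t : ℝ} (hX : IsClosed X) (hb : IsGreatest X b)
    (ht : t ∈ kappaUp X) (h : sigma X t < b ∨ t = b) : sigma (kappaUp X) t = sigma X t := by
  have htX := ((mem_kappaUp hb).1 ht).1
  rcases h with h | rfl
  · have hs : sigma X t ∈ kappaUp X := mem_kappaUp_of_lt hb (sigma_mem hX htX) h
    apply le_antisymm
    · rcases (le_sigma X t).eq_or_lt with he | hlt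
      · apply le_of_forall_gt
        intro z hz
        obtain ⟨s, hs, hts, hsz⟩ := exists_lt_of_sigma_lt (X := X) (t := t) (z := min z b)
          ⟨b, hb.1, (le_sigma X t).trans_lt h⟩ (lt_min hz h)
        exact (sigma_le (mem_kappaUp_of_lt hb hs (hsz.trans_le (min_le_right _ _))) hts).trans_lt
          (hsz.trans_le (min_le_left _ _))
      · exact sigma_le hs hlt
    · by_cases hne : (kappaUp X ∩ Ioi t).Nonempty
      · rw [sigma.eq_1 (kappaUp X), if_pos hne]
        exact le_csInf hne fun x hx => sigma_le ((mem_kappaUp hb).1 hx.1).1 hx.2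
      · have : sigma X t = t := by
          by_contra hc
          exact hne ⟨_, hs, lt_of_le_of_ne (le_sigma X t) (Ne.symm hc)⟩
        rw [this]; exact le_sigma _ _
  · have h1 : rho X t = t := rho_eq_of_mem_kappaUp hb ht
    have h2 := isGreatest_kappaUp hX hb
    rw [h1] at h2
    rw [sigma_of_isGreatest hb, sigma_of_isGreatest h2]

/-! ### The largest point of the time scale below a given real -/

/-- The largest point of `X` that is at most `t`. -/
noncomputable def floor (X : Set ℝ) (t : ℝ) : ℝ := sSup (X ∩ Iic t)

section floor

variable {X : Set ℝ} {a t s : ℝ}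

theorem floor_le (ha : IsLeast X a) (h : a ≤ t) : floor X t ≤ t :=
  csSup_le ⟨a, ha.1, h⟩ fun _ hx => hx.2

theorem le_floor (hs : s ∈ X) (h : s ≤ t) : s ≤ floor X t :=
  le_csSup ⟨t, fun _ hx => hx.2⟩ ⟨hs, h⟩

theorem floor_mem (hX : IsClosed X) (ha : IsLeast X a) (h : a ≤ t) : floor X t ∈ X :=
  ((hX.inter isClosed_Iic).csSup_mem ⟨a, ha.1, h⟩ ⟨t, fun _ hx => hx.2⟩).1

theorem le_floor_iff (ha : IsLeast X a) (hs : s ∈ X) (h : a ≤ t) : s ≤ floor X t ↔ s ≤ t :=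
  ⟨fun h' => h'.trans (floor_le ha h), le_floor hs⟩

theorem floor_mono (ha : IsLeast X a) : MonotoneOn (floor X) (Ici a) := fun _ hs t _ hst =>
  csSup_le_csSup ⟨t, fun _ hx => hx.2⟩ ⟨a, ha.1, hs⟩ fun _ hx => ⟨hx.1, le_trans hx.2 hst⟩

theorem floor_of_lt (ha : IsLeast X a) (h : t < a) : floor X t = 0 := by
  have : X ∩ Iic t = ∅ := by
    ext x
    simp only [mem_inter_iff, mem_Iic, mem_empty_iff_false, iff_false, not_and, not_le]
    exact fun hx => h.trans_le (ha.2 hx)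
  rw [floor, this, Real.sSup_empty]

/-- `floor X` is monotone on `[a, ∞)`, and to the left of `a` it is the default value `sSup ∅ = 0`;
it need not be monotone across `a`, so the two pieces are glued. -/
theorem measurable_floor (ha : IsLeast X a) : Measurable (floor X) := by
  have h : floor X = fun t => if t < a then 0 else floor X (max a t) := by
    funext t
    split_ifs with h
    · exact floor_of_lt ha h
    · rw [max_eq_right (not_lt.1 h)]
  rw [h]
  refine Measurable.ite measurableSet_Iio measurable_const (Monotone.measurable ?_)
  exact fun s t hst => floor_mono ha (mem_Ici.2 (le_max_left a s)) (mem_Ici.2 (le_max_left a t))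
    (max_le_max le_rfl hst)

theorem floor_le_of_lt_sigma (hX : IsClosed X) (ha : IsLeast X a) (hs : a ≤ s)
    (h : s < sigma X t) : floor X s ≤ t :=
  le_of_lt_sigma (floor_mem hX ha hs) ((floor_le ha hs).trans_lt h)

theorem lt_floor_of_sigma_lt {b : ℝ} (hX : IsClosed X) (hb : IsGreatest X b) (ht : t ∈ X)
    (htb : t < b) (h : sigma X t < s) : t < floor X s := by
  rcases (le_sigma X t).eq_or_lt with he | hlt
  · obtain ⟨z, hz, htz, hzs⟩ := exists_lt_of_sigma_lt ⟨b, hb.1, htb⟩ h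
    exact htz.trans_le (le_floor hz hzs.le)
  · exact hlt.trans_le (le_floor (sigma_mem hX ht) h.le)

theorem floor_eq_of_lt_sigma (hX : IsClosed X) (ha : IsLeast X a) (ht : t ∈ X) (hs : t ≤ s)
    (h : s < sigma X t) : floor X s = t :=
  le_antisymm (floor_le_of_lt_sigma hX ha ((ha.2 ht).trans hs) h) (le_floor ht hs)

end floor

/-! ### Urysohn functions that are constant on disjoint closed intervals -/

section Urysohn

variable {J : Set (ℝ × ℝ)}

/-- `U` contains every interval of the family `J` that it meets. -/
def Saturated (J : Set (ℝ × ℝ)) (U : Set ℝ) : Prop :=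
  ∀ p ∈ J, (Icc p.1 p.2 ∩ U).Nonempty → Icc p.1 p.2 ⊆ U

/-- The largest saturated subset of `U`. -/
def saturatedCore (J : Set (ℝ × ℝ)) (U : Set ℝ) : Set ℝ :=
  {x | x ∈ U ∧ ∀ p ∈ J, x ∈ Icc p.1 p.2 → Icc p.1 p.2 ⊆ U}

theorem saturatedCore_subset (U : Set ℝ) : saturatedCore J U ⊆ U := fun _ hx => hx.1

theorem Saturated.subset_core {U A : Set ℝ} (hA : Saturated J A) (h : A ⊆ U) :
    A ⊆ saturatedCore J U :=
  fun x hx => ⟨h hx, fun p hp hxp => (hA p hp ⟨x, hxp, hx⟩).trans h⟩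

theorem Saturated.compl {U : Set ℝ} (h : Saturated J U) : Saturated J Uᶜ := by
  rintro p hp ⟨x, hxp, hxU⟩ y hy hyU
  exact hxU (h p hp ⟨y, hy, hyU⟩ hxp)

theorem saturated_core (hdisj : ∀ p ∈ J, ∀ q ∈ J, (Icc p.1 p.2 ∩ Icc q.1 q.2).Nonempty → p = q)
    (U : Set ℝ) : Saturated J (saturatedCore J U) := by
  rintro p hp ⟨x, hxp, hxU, hx⟩ y hy
  refine ⟨hx p hp hxp hy, fun q hq hyq => ?_⟩
  rw [← hdisj p hp q hq ⟨y, hy, hyq⟩]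
  exact hx p hp hxp

/-- If `x` lies in an interval of `J` and is not its right end, that interval does the job.
Otherwise every interval meeting `(x, ∞)` starts to the right of `x`. At most one of them starts
inside `(x, x + ε)` and reaches `x + ε`; stopping at its left end leaves only intervals contained in
`(x, x + ε) ⊆ U`. -/
theorem exists_Ioo_right_subset_core
    (hdisj : ∀ p ∈ J, ∀ q ∈ J, (Icc p.1 p.2 ∩ Icc q.1 q.2).Nonempty → p = q)
    {U : Set ℝ} (hU : IsOpen U) {x : ℝ} (hx : x ∈ saturatedCore J U) :
    ∃ z > x, Ioo x z ⊆ saturatedCore J U := by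
  by_cases h1 : ∃ p ∈ J, x ∈ Icc p.1 p.2 ∧ x < p.2
  · obtain ⟨p, hp, hxp, hlt⟩ := h1
    refine ⟨p.2, hlt, fun y hy => ?_⟩
    exact saturated_core hdisj U p hp ⟨x, hxp, hx⟩ ⟨hxp.1.trans hy.1.le, hy.2.le⟩
  have hleft : ∀ q ∈ J, ∀ y, x < y → y ∈ Icc q.1 q.2 → x < q.1 := by
    intro q hq y hxy hyq
    by_contra hc
    exact h1 ⟨q, hq, ⟨not_lt.1 hc, (hxy.trans_le hyq.2).le⟩, hxy.trans_le hyq.2⟩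
  obtain ⟨ε, hε, hball⟩ := Metric.isOpen_iff.1 hU x hx.1
  rw [Real.ball_eq_Ioo] at hball
  have hIoo : Ioo x (x + ε) ⊆ U := fun y hy => hball ⟨by linarith [hy.1], hy.2⟩
  by_cases h2 : ∃ p ∈ J, x < p.1 ∧ p.1 < x + ε ∧ x + ε ≤ p.2
  · obtain ⟨p, hp, hxp, hp1, hp2⟩ := h2
    refine ⟨p.1, hxp, fun y hy => ⟨hIoo ⟨hy.1, hy.2.trans hp1⟩, fun q hq hyq w hw => ?_⟩⟩
    have hq1 := hleft q hq y hy.1 hyq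
    have hq2 : q.2 < p.1 := by
      by_contra hc
      have := hdisj p hp q hq
        ⟨p.1, ⟨le_rfl, by linarith⟩, ⟨hyq.1.trans hy.2.le, not_lt.1 hc⟩⟩
      subst this
      exact absurd hy.2 (not_lt.2 hyq.1)
    exact hIoo ⟨hq1.trans_le hw.1, by linarith [hw.2]⟩
  · refine ⟨x + ε, by linarith, fun y hy => ⟨hIoo hy, fun q hq hyq w hw => ?_⟩⟩
    have hq1 := hleft q hq y hy.1 hyq
    have hq2 : q.2 < x + ε := by
      by_contra hc
      exact h2 ⟨q, hq, hq1, hyq.1.trans_lt hy.2, not_lt.1 hc⟩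
    exact hIoo ⟨hq1.trans_le hw.1, hw.2.trans_lt hq2⟩

theorem exists_Ioo_left_subset_core
    (hdisj : ∀ p ∈ J, ∀ q ∈ J, (Icc p.1 p.2 ∩ Icc q.1 q.2).Nonempty → p = q)
    {U : Set ℝ} (hU : IsOpen U) {x : ℝ} (hx : x ∈ saturatedCore J U) :
    ∃ z < x, Ioo z x ⊆ saturatedCore J U := by
  by_cases h1 : ∃ p ∈ J, x ∈ Icc p.1 p.2 ∧ p.1 < x
  · obtain ⟨p, hp, hxp, hlt⟩ := h1
    refine ⟨p.1, hlt, fun y hy => ?_⟩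
    exact saturated_core hdisj U p hp ⟨x, hxp, hx⟩ ⟨hy.1.le, hy.2.le.trans hxp.2⟩
  have hright : ∀ q ∈ J, ∀ y, y < x → y ∈ Icc q.1 q.2 → q.2 < x := by
    intro q hq y hxy hyq
    by_contra hc
    exact h1 ⟨q, hq, ⟨(hyq.1.trans_lt hxy).le, not_lt.1 hc⟩, hyq.1.trans_lt hxy⟩
  obtain ⟨ε, hε, hball⟩ := Metric.isOpen_iff.1 hU x hx.1
  rw [Real.ball_eq_Ioo] at hball
  have hIoo : Ioo (x - ε) x ⊆ U := fun y hy => hball ⟨hy.1, by linarith [hy.2]⟩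
  by_cases h2 : ∃ p ∈ J, p.2 < x ∧ x - ε < p.2 ∧ p.1 ≤ x - ε
  · obtain ⟨p, hp, hxp, hp1, hp2⟩ := h2
    refine ⟨p.2, hxp, fun y hy => ⟨hIoo ⟨hp1.trans hy.1, hy.2⟩, fun q hq hyq w hw => ?_⟩⟩
    have hq1 := hright q hq y hy.2 hyq
    have hq2 : p.2 < q.1 := by
      by_contra hc
      have := hdisj p hp q hq
        ⟨p.2, ⟨by linarith, le_rfl⟩, ⟨not_lt.1 hc, hy.1.le.trans hyq.2⟩⟩
      subst this
      exact absurd hy.1 (not_lt.2 hyq.2)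
    exact hIoo ⟨by linarith [hw.1], hw.2.trans_lt hq1⟩
  · refine ⟨x - ε, by linarith, fun y hy => ⟨hIoo hy, fun q hq hyq w hw => ?_⟩⟩
    have hq1 := hright q hq y hy.2 hyq
    have hq2 : x - ε < q.1 := by
      by_contra hc
      exact h2 ⟨q, hq, hq1, hy.1.trans_le hyq.2, not_lt.1 hc⟩
    exact hIoo ⟨hq2.trans_le hw.1, hw.2.trans_lt hq1⟩

theorem isOpen_saturatedCore
    (hdisj : ∀ p ∈ J, ∀ q ∈ J, (Icc p.1 p.2 ∩ Icc q.1 q.2).Nonempty → p = q)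
    {U : Set ℝ} (hU : IsOpen U) : IsOpen (saturatedCore J U) := by
  rw [isOpen_iff_mem_nhds]
  intro x hx
  obtain ⟨z, hz, hr⟩ := exists_Ioo_right_subset_core hdisj hU hx
  obtain ⟨w, hw, hl⟩ := exists_Ioo_left_subset_core hdisj hU hx
  filter_upwards [Ioo_mem_nhds hw hz] with y hy
  rcases lt_trichotomy y x with h | rfl | h
  · exact hl ⟨hy.1, h⟩
  · exact hx
  · exact hr ⟨h, hy.2⟩

/-- The topology of the saturated open sets. -/
@[reducible] def saturatedTopology (J : Set (ℝ × ℝ)) : TopologicalSpace ℝ where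
  IsOpen U := IsOpen U ∧ Saturated J U
  isOpen_univ := ⟨isOpen_univ, fun _ _ _ => subset_univ _⟩
  isOpen_inter _ _ hU hV := ⟨hU.1.inter hV.1, fun p hp ⟨x, hx, hxU, hxV⟩ =>
    subset_inter (hU.2 p hp ⟨x, hx, hxU⟩) (hV.2 p hp ⟨x, hx, hxV⟩)⟩
  isOpen_sUnion _ hS := ⟨isOpen_sUnion fun U hU => (hS U hU).1,
    fun p hp ⟨x, hx, U, hU, hxU⟩ =>
      ((hS U hU).2 p hp ⟨x, hx, hxU⟩).trans (subset_sUnion_of_mem hU)⟩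

/-- Separate the two closed sets in the usual topology and pass to saturated cores: these are still
open and disjoint, and they still contain the two sets because those are saturated. -/
theorem normalSpace_saturatedTopology
    (hdisj : ∀ p ∈ J, ∀ q ∈ J, (Icc p.1 p.2 ∩ Icc q.1 q.2).Nonempty → p = q) :
    @NormalSpace ℝ (saturatedTopology J) := by
  refine @NormalSpace.mk ℝ (saturatedTopology J) fun A B hA hB hAB => ?_
  have hA' := (@isOpen_compl_iff ℝ A (saturatedTopology J)).2 hA
  have hB' := (@isOpen_compl_iff ℝ B (saturatedTopology J)).2 hB
  obtain ⟨U, V, hU, hV, hAU, hBV, hUV⟩ :=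
    normal_separation (isOpen_compl_iff.1 hA'.1) (isOpen_compl_iff.1 hB'.1) hAB
  refine ⟨saturatedCore J U, saturatedCore J V,
    ⟨isOpen_saturatedCore hdisj hU, saturated_core hdisj U⟩,
    ⟨isOpen_saturatedCore hdisj hV, saturated_core hdisj V⟩, ?_, ?_,
    hUV.mono (saturatedCore_subset U) (saturatedCore_subset V)⟩
  · exact Saturated.subset_core (by simpa using hA'.2.compl) hAU
  · exact Saturated.subset_core (by simpa using hB'.2.compl) hBV

theorem exists_continuous_const_on_intervals
    (hdisj : ∀ p ∈ J, ∀ q ∈ J, (Icc p.1 p.2 ∩ Icc q.1 q.2).Nonempty → p = q)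
    {A B : Set ℝ} (hA : IsClosed A) (hAJ : Saturated J A) (hB : IsClosed B)
    (hAB : Disjoint A B) :
    ∃ k : ℝ → ℝ, Continuous k ∧ (∀ x ∈ A, k x = 1) ∧ (∀ x ∈ B, k x = 0) ∧
      (∀ x, k x ∈ Icc (0 : ℝ) 1) ∧ ∀ p ∈ J, ∀ x ∈ Icc p.1 p.2, ∀ y ∈ Icc p.1 p.2, k x = k y := by
  -- `B` need not be saturated, so it is enlarged to the complement of the core of `Bᶜ`, which is
  -- closed and saturated and still misses `A`.
  have hC : @IsClosed ℝ (saturatedTopology J) (saturatedCore J Bᶜ)ᶜ := by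
    rw [← @isOpen_compl_iff ℝ _ (saturatedTopology J), compl_compl]
    exact ⟨isOpen_saturatedCore hdisj hB.isOpen_compl, saturated_core hdisj _⟩
  have hA' : @IsClosed ℝ (saturatedTopology J) A := by
    rw [← @isOpen_compl_iff ℝ _ (saturatedTopology J)]
    exact ⟨hA.isOpen_compl, hAJ.compl⟩
  have hd : Disjoint (saturatedCore J Bᶜ)ᶜ A :=
    (disjoint_compl_left_iff_subset).2 (hAJ.subset_core hAB.subset_compl_right)
  obtain ⟨⟨k, hkc⟩, hk0, hk1, hk⟩ := @exists_continuous_zero_one_of_isClosed ℝ (saturatedTopology J)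
    (normalSpace_saturatedTopology hdisj) _ _ hC hA' hd
  have hopen : ∀ V : Set ℝ, IsOpen V → IsOpen (k ⁻¹' V) ∧ Saturated J (k ⁻¹' V) :=
    @Continuous.isOpen_preimage ℝ ℝ (saturatedTopology J) _ k hkc
  refine ⟨k, continuous_def.2 fun V hV => (hopen V hV).1, fun x hx => hk1 hx,
    fun x hx => hk0 fun hc => hc.1 hx, hk, fun p hp x hx y hy => ?_⟩
  by_contra hne
  -- A level-set complement is saturated: if it meets an interval of `J` at `x`, it contains the
  -- whole interval, including `y`.
  have := (hopen {k y}ᶜ isOpen_compl_singleton).2 p hp ⟨x, hx, hne⟩ hy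
  exact this rfl

end Urysohn

/-! ### Uniqueness and algebra of delta derivatives -/

section deriv

variable {X : Set ℝ} {a b t : ℝ}

theorem HasDeltaDeriv.congr {f g : ℝ → ℝ} {d : ℝ} (h : HasDeltaDeriv X f t d)
    (hσ : g (sigma X t) = f (sigma X t)) {r : ℝ} (hr : 0 < r)
    (hfg : ∀ s ∈ X, |s - t| < r → g s = f s) : HasDeltaDeriv X g t d := by
  refine ⟨h.1, fun ε hε => ?_⟩
  obtain ⟨δ, hδ, H⟩ := h.2 ε hε
  refine ⟨min δ r, lt_min hδ hr, fun s hs hst => ?_⟩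
  rw [hσ, hfg s hs (hst.trans_le (min_le_right _ _))]
  exact H s hs (hst.trans_le (min_le_left _ _))

/-- This is where `X^κ` matters: a left-scattered maximum is excluded, so the condition defining the
delta derivative is never vacuous near `t`. -/
theorem exists_mem_ne_sigma (ha : IsLeast X a) (hb : IsGreatest X b) (hab : a < b)
    (ht : t ∈ kappaUp X) {δ : ℝ} (hδ : 0 < δ) : ∃ s ∈ X, |s - t| < δ ∧ s ≠ sigma X t := by
  obtain ⟨htX, htρ⟩ := (mem_kappaUp hb).1 ht
  rcases (le_sigma X t).eq_or_lt with he | hlt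
  · rcases (hb.2 htX).eq_or_lt with rfl | htb
    · obtain ⟨s, hs, h1, h2⟩ := exists_lt_of_rho_eq ha.1 hab
        (le_antisymm (rho_le X t) htρ) (sub_lt_self t hδ)
      refine ⟨s, hs, abs_lt.2 ⟨by linarith, by linarith⟩, ?_⟩
      rw [← he]; exact h2.ne
    · obtain ⟨s, hs, h1, h2⟩ := exists_lt_of_sigma_eq hb.1 htb he.symm (lt_add_of_pos_right t hδ)
      refine ⟨s, hs, abs_lt.2 ⟨by linarith, by linarith⟩, ?_⟩
      rw [← he]; exact h1.ne'
  · exact ⟨t, htX, by simpa using hδ, hlt.ne⟩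

theorem HasDeltaDeriv.unique (ha : IsLeast X a) (hb : IsGreatest X b) (hab : a < b)
    {f : ℝ → ℝ} {d e : ℝ} (hd : HasDeltaDeriv X f t d) (he : HasDeltaDeriv X f t e) :
    d = e := by
  by_contra hne
  have hpos : 0 < |d - e| := abs_pos.2 (sub_ne_zero.2 hne)
  obtain ⟨δ₁, hδ₁, H₁⟩ := hd.2 (|d - e| / 4) (by positivity)
  obtain ⟨δ₂, hδ₂, H₂⟩ := he.2 (|d - e| / 4) (by positivity)
  obtain ⟨s, hs, hst, hsσ⟩ := exists_mem_ne_sigma ha hb hab hd.1 (lt_min hδ₁ hδ₂)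
  have h1 := H₁ s hs (hst.trans_le (min_le_left _ _))
  have h2 := H₂ s hs (hst.trans_le (min_le_right _ _))
  have hp : 0 < |sigma X t - s| := abs_pos.2 (sub_ne_zero.2 hsσ.symm)
  have h3 : |d - e| * |sigma X t - s| ≤ |d - e| / 4 * |sigma X t - s| +
      |d - e| / 4 * |sigma X t - s| := by
    rw [← abs_mul]
    refine le_trans ?_ (add_le_add h2 h1)
    refine le_trans (le_of_eq ?_) (abs_sub _ _)
    congr 1; ring
  nlinarith

theorem HasDeltaDeriv.deltaDeriv_eq (ha : IsLeast X a) (hb : IsGreatest X b) (hab : a < b)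
    {f : ℝ → ℝ} {d : ℝ} (hd : HasDeltaDeriv X f t d) : deltaDeriv X f t = d := by
  have h : ∃ d, HasDeltaDeriv X f t d := ⟨d, hd⟩
  rw [deltaDeriv, dif_pos h]
  exact h.choose_spec.unique ha hb hab hd

theorem HasDeltaDeriv.add_const_mul {f g : ℝ → ℝ} {d e : ℝ} (hf : HasDeltaDeriv X f t d)
    (hg : HasDeltaDeriv X g t e) (c : ℝ) :
    HasDeltaDeriv X (fun s => f s + c * g s) t (d + c * e) := by
  refine ⟨hf.1, fun ε hε => ?_⟩
  have hc : 0 < 2 * (|c| + 1) := by positivity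
  obtain ⟨δ₁, hδ₁, H₁⟩ := hf.2 (ε / 2) (by positivity)
  obtain ⟨δ₂, hδ₂, H₂⟩ := hg.2 (ε / (2 * (|c| + 1))) (by positivity)
  refine ⟨min δ₁ δ₂, lt_min hδ₁ hδ₂, fun s hs hst => ?_⟩
  have h1 := H₁ s hs (hst.trans_le (min_le_left _ _))
  have h2 := H₂ s hs (hst.trans_le (min_le_right _ _))
  have h3 : |c| * |g (sigma X t) - g s - e * (sigma X t - s)| ≤ ε / 2 * |sigma X t - s| := by
    calc _ ≤ (|c| + 1) * (ε / (2 * (|c| + 1)) * |sigma X t - s|) := by gcongr; linarith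
      _ = ε / 2 * |sigma X t - s| := by field_simp
  rw [← abs_mul] at h3
  calc _ = |(f (sigma X t) - f s - d * (sigma X t - s)) +
        c * (g (sigma X t) - g s - e * (sigma X t - s))| := by congr 1; ring
    _ ≤ _ := abs_add_le _ _
    _ ≤ ε / 2 * |sigma X t - s| + ε / 2 * |sigma X t - s| := add_le_add h1 h3
    _ = _ := by ring

theorem HasDeltaDeriv.const_mul {f : ℝ → ℝ} {d : ℝ} (hf : HasDeltaDeriv X f t d) (c : ℝ) :
    HasDeltaDeriv X (fun s => c * f s) t (c * d) := by
  have h0 : HasDeltaDeriv X (fun _ => 0) t 0 :=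
    ⟨hf.1, fun ε hε => ⟨1, one_pos, fun s _ _ => by simp; positivity⟩⟩
  simpa using h0.add_const_mul hf c

theorem HasDeltaDeriv.continuousWithinAt {f : ℝ → ℝ} {d : ℝ} (ht : t ∈ X)
    (h : HasDeltaDeriv X f t d) : ContinuousWithinAt f X t := by
  rw [Metric.continuousWithinAt_iff]
  intro ε hε
  -- `M` bounds `|σ t - s|` for `|s - t| < 1`. Subtracting the estimates at `s` and at `t`
  -- eliminates `f (σ t)`.
  set M := |sigma X t - t| + 1 with hM
  have hMpos : 0 < M := by positivity
  obtain ⟨δ, hδ, H⟩ := h.2 (ε / (4 * M)) (by positivity)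
  refine ⟨min (min δ 1) (ε / (4 * (|d| + 1))), by positivity, fun s hs hst => ?_⟩
  rw [Real.dist_eq] at hst ⊢
  obtain ⟨h1, h2⟩ := lt_min_iff.1 hst
  obtain ⟨h0, h1⟩ := lt_min_iff.1 h1
  have e1 := H s hs h0
  have e2 := H t ht (by simpa using hδ)
  have b1 : |sigma X t - s| ≤ M := by
    calc |sigma X t - s| = |(sigma X t - t) - (s - t)| := by congr 1; ring
      _ ≤ |sigma X t - t| + |s - t| := abs_sub _ _
      _ ≤ M := by linarith
  have b2 : |sigma X t - t| ≤ M := by linarith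
  have c1 : ε / (4 * M) * |sigma X t - s| ≤ ε / 4 := by
    calc _ ≤ ε / (4 * M) * M := by gcongr
      _ = ε / 4 := by field_simp
  have c2 : ε / (4 * M) * |sigma X t - t| ≤ ε / 4 := by
    calc _ ≤ ε / (4 * M) * M := by gcongr
      _ = ε / 4 := by field_simp
  have c3 : |d * (s - t)| ≤ ε / 4 := by
    rw [abs_mul]
    calc |d| * |s - t| ≤ (|d| + 1) * (ε / (4 * (|d| + 1))) := by
          gcongr; linarith
      _ = ε / 4 := by field_simp
  have : f s - f t = (f (sigma X t) - f t - d * (sigma X t - t)) -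
      (f (sigma X t) - f s - d * (sigma X t - s)) + d * (s - t) := by ring
  rw [this]
  refine (abs_add_le _ _).trans_lt ?_
  have := abs_sub (f (sigma X t) - f t - d * (sigma X t - t))
      (f (sigma X t) - f s - d * (sigma X t - s))
  linarith

end deriv

/-! ### Reflection -/

/-- The outer minus sign in `-f(-s)` cancels the one from the chain rule, so the derivative keeps
its value. -/
theorem hasDeltaDeriv_neg_iff {X : Set ℝ} {f : ℝ → ℝ} {t d : ℝ} :
    HasDeltaDeriv (-X) (fun s => -f (-s)) (-t) d ↔ HasNablaDeriv X f t d := by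
  unfold HasDeltaDeriv HasNablaDeriv
  rw [kappaUp_neg, Set.neg_mem_neg, sigma_neg]
  refine and_congr_right fun _ => forall₂_congr fun ε _ => exists_congr fun δ =>
    and_congr_right fun _ => ?_
  have key : ∀ s, (|-f (- -rho X t) - -f (- -s) - d * (-rho X t - -s)| ≤ ε * |-rho X t - -s|) =
      (|f (rho X t) - f s - d * (rho X t - s)| ≤ ε * |rho X t - s|) := fun s => by
    simp only [neg_neg]
    rw [← abs_neg (-rho X t - -s), ← abs_neg (f (rho X t) - f s - d * (rho X t - s))]
    congr 2
    · ring
    · congr 1; ring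
  constructor
  · intro h s hs hst
    have := h (-s) (by simpa using hs) (by rw [← abs_neg]; convert hst using 2; ring)
    rwa [key] at this
  · intro h s hs hst
    have := h (-s) hs (by rw [← abs_neg]; convert hst using 2; ring)
    rwa [← key, neg_neg s] at this

theorem hasNablaDeriv_neg_iff {X : Set ℝ} {f : ℝ → ℝ} {t d : ℝ} :
    HasNablaDeriv (-X) (fun s => -f (-s)) (-t) d ↔ HasDeltaDeriv X f t d := by
  rw [← hasDeltaDeriv_neg_iff]; simp

open Classical in
-- Equivalent predicates are equal, so the chosen values coincide even where derivatives are not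
-- unique or do not exist. Reflection of derivatives thus needs no hypotheses.
theorem dite_choose_congr {P Q : ℝ → Prop} (h : ∀ d, P d ↔ Q d) :
    (if h : ∃ d, P d then h.choose else 0) = if h : ∃ d, Q d then h.choose else 0 := by
  obtain rfl : P = Q := funext fun d => propext (h d)
  rfl

theorem deltaDeriv_neg (X : Set ℝ) (f : ℝ → ℝ) (t : ℝ) :
    deltaDeriv (-X) (fun s => -f (-s)) (-t) = nablaDeriv X f t := by
  exact dite_choose_congr fun _ => hasDeltaDeriv_neg_iff

theorem nablaDeriv_neg (X : Set ℝ) (f : ℝ → ℝ) (t : ℝ) :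
    nablaDeriv (-X) (fun s => -f (-s)) (-t) = deltaDeriv X f t := by
  rw [← deltaDeriv_neg]; simp

theorem HasNablaDeriv.nablaDeriv_eq {X : Set ℝ} {a b t : ℝ} (ha : IsLeast X a)
    (hb : IsGreatest X b) (hab : a < b)
    {f : ℝ → ℝ} {d : ℝ} (hd : HasNablaDeriv X f t d) : nablaDeriv X f t = d := by
  rw [← deltaDeriv_neg]
  exact (hasDeltaDeriv_neg_iff.2 hd).deltaDeriv_eq (isLeast_neg hb) (isGreatest_neg ha)
    (neg_lt_neg hab)

theorem HasNablaDeriv.add_const_mul {X : Set ℝ} {t : ℝ} {f g : ℝ → ℝ} {d e : ℝ}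
    (hf : HasNablaDeriv X f t d) (hg : HasNablaDeriv X g t e) (c : ℝ) :
    HasNablaDeriv X (fun s => f s + c * g s) t (d + c * e) := by
  rw [← hasDeltaDeriv_neg_iff] at hf hg ⊢
  convert hf.add_const_mul hg c using 2
  ring

theorem HasNablaDeriv.const_mul {X : Set ℝ} {t : ℝ} {f : ℝ → ℝ} {d : ℝ}
    (hf : HasNablaDeriv X f t d) (c : ℝ) :
    HasNablaDeriv X (fun s => c * f s) t (c * d) := by
  rw [← hasDeltaDeriv_neg_iff] at hf ⊢
  convert hf.const_mul c using 2
  ring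

theorem C1Diamond.neg {X : Set ℝ} {f : ℝ → ℝ} (h : C1Diamond X f) :
    C1Diamond (-X) (fun s => -f (-s)) where
  delta_exists t ht := by
    rw [kappaUp_neg] at ht
    obtain ⟨d, hd⟩ := h.nabla_exists (-t) ht
    exact ⟨d, by simpa using hasDeltaDeriv_neg_iff.2 hd⟩
  nabla_exists t ht := by
    rw [kappaDown_neg] at ht
    obtain ⟨d, hd⟩ := h.delta_exists (-t) ht
    exact ⟨d, by simpa using hasNablaDeriv_neg_iff.2 hd⟩
  delta_cont := by
    have : deltaDeriv (-X) (fun s => -f (-s)) = nablaDeriv X f ∘ fun t => -t := by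
      funext t; simpa using deltaDeriv_neg X f (-t)
    rw [this, kappaUp_neg]
    exact h.nabla_cont.comp continuous_neg.continuousOn fun x hx => hx
  nabla_cont := by
    have : nablaDeriv (-X) (fun s => -f (-s)) = deltaDeriv X f ∘ fun t => -t := by
      funext t; simpa using nablaDeriv_neg X f (-t)
    rw [this, kappaDown_neg]
    exact h.delta_cont.comp continuous_neg.continuousOn fun x hx => hx

theorem supNorm_neg (X : Set ℝ) (f : ℝ → ℝ) : supNorm (-X) f = supNorm X (fun t => f (-t)) := by
  unfold supNorm
  have h : kappaUp (-X) ∩ kappaDown (-X) = -(kappaUp X ∩ kappaDown X) := by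
    rw [kappaUp_neg, kappaDown_neg, Set.inter_neg, inter_comm]
  rw [h]
  exact (Equiv.iSup_congr ⟨fun x => ⟨-x.1, x.2⟩, fun x => ⟨-x.1, Set.neg_mem_neg.2 x.2⟩,
    fun x => by simp, fun x => by simp⟩ fun x => by simp)

theorem norm1_neg (X : Set ℝ) (f : ℝ → ℝ) : norm1 (-X) (fun s => -f (-s)) = norm1 X f := by
  unfold norm1
  simp only [supNorm_neg, sigma_neg, rho_neg, deltaDeriv_neg, nablaDeriv_neg, neg_neg]
  have h : ∀ g : ℝ → ℝ, supNorm X (fun t => -g t) = supNorm X g := fun g => by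
    simp [supNorm]
  rw [h fun t => f (rho X t), h fun t => f (sigma X t)]
  ring

theorem C1Diamond.add_const_mul {X : Set ℝ} {a b : ℝ} (ha : IsLeast X a) (hb : IsGreatest X b)
    (hab : a < b) {f g : ℝ → ℝ} (hf : C1Diamond X f) (hg : C1Diamond X g) (c : ℝ) :
    C1Diamond X (fun s => f s + c * g s) where
  delta_exists t ht := by
    obtain ⟨d, hd⟩ := hf.delta_exists t ht
    obtain ⟨e, he⟩ := hg.delta_exists t ht
    exact ⟨_, hd.add_const_mul he c⟩
  nabla_exists t ht := by
    obtain ⟨d, hd⟩ := hf.nabla_exists t ht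
    obtain ⟨e, he⟩ := hg.nabla_exists t ht
    exact ⟨_, hd.add_const_mul he c⟩
  delta_cont := by
    refine (hf.delta_cont.add (hg.delta_cont.const_smul c)).congr fun t ht => ?_
    obtain ⟨d, hd⟩ := hf.delta_exists t ht
    obtain ⟨e, he⟩ := hg.delta_exists t ht
    simp [(hd.add_const_mul he c).deltaDeriv_eq ha hb hab, hd.deltaDeriv_eq ha hb hab,
      he.deltaDeriv_eq ha hb hab]
  nabla_cont := by
    refine (hf.nabla_cont.add (hg.nabla_cont.const_smul c)).congr fun t ht => ?_
    obtain ⟨d, hd⟩ := hf.nabla_exists t ht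
    obtain ⟨e, he⟩ := hg.nabla_exists t ht
    simp [(hd.add_const_mul he c).nablaDeriv_eq ha hb hab, hd.nablaDeriv_eq ha hb hab,
      he.nablaDeriv_eq ha hb hab]

/-! ### Regular functions and their primitives -/

theorem continuousWithinAt_sigma {X : Set ℝ} {b t : ℝ} (hb : IsGreatest X b) (ht : t ∈ X)
    (h : sigma X t = t) : ContinuousWithinAt (sigma X) X t := by
  rw [Metric.continuousWithinAt_iff, h]
  intro ε hε
  rcases (hb.2 ht).eq_or_lt with rfl | htb
  · refine ⟨ε, hε, fun s hs hst => ?_⟩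
    rw [Real.dist_eq, abs_lt] at hst ⊢
    rcases (hb.2 hs).eq_or_lt with rfl | hlt
    · rw [h]; constructor <;> linarith
    · have := sigma_le ht hlt
      have := le_sigma X s
      constructor <;> linarith
  · obtain ⟨z, hz, htz, hzε⟩ := exists_lt_of_sigma_eq hb.1 htb h (lt_add_of_pos_right t hε)
    refine ⟨z - t, by linarith, fun s hs hst => ?_⟩
    rw [Real.dist_eq, abs_lt] at hst ⊢
    have := sigma_le hz (show s < z by linarith)
    have := le_sigma X s
    constructor <;> linarith

theorem continuousWithinAt_rho {X : Set ℝ} {a t : ℝ} (ha : IsLeast X a) (ht : t ∈ X)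
    (h : rho X t = t) : ContinuousWithinAt (rho X) X t := by
  have h1 := continuousWithinAt_sigma (isGreatest_neg ha) (t := -t) (by simpa using ht)
    (by rw [sigma_neg, h])
  have h2 : rho X = fun s => -sigma (-X) (-s) := funext fun s => rho_eq X s
  rw [h2]
  exact (h1.comp continuous_neg.continuousWithinAt fun s hs => Set.neg_mem_neg.2 hs).neg

theorem sigma_rho {X : Set ℝ} {t : ℝ} (ht : t ∈ X) (h : rho X t < t) :
    sigma X (rho X t) = t := by
  refine le_antisymm (sigma_le ht h) ?_
  by_contra hc
  obtain ⟨s, hs, h1, h2⟩ := exists_lt_of_sigma_lt ⟨t, ht, h⟩ (not_le.1 hc)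
  exact absurd (le_rho hs h2) (not_le.2 h1)

/-- `p` is bounded on `X`, continuous at the right-dense points of `X`, and its extension that is
constant on the gaps of `X` is measurable. -/
structure IsRegular (X : Set ℝ) (p : ℝ → ℝ) : Prop where
  bounded : ∃ C, 0 ≤ C ∧ ∀ t ∈ X, |p t| ≤ C
  cont : ∀ t ∈ X, sigma X t = t → ContinuousWithinAt p X t
  meas : Measurable fun t => p (floor X t)

/-- The primitive `t ↦ ∫_a^t p Δs` of `p`, extended affinely to the gaps of `X`. -/
noncomputable def primitive (X : Set ℝ) (a : ℝ) (p : ℝ → ℝ) (t : ℝ) : ℝ :=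
  ∫ s in a..t, p (floor X s)

section regular

variable {X : Set ℝ} {a b t : ℝ} {p : ℝ → ℝ}

theorem isRegular_sigma (hX : IsClosed X) (ha : IsLeast X a) (hb : IsGreatest X b)
    {q : ℝ × ℝ → ℝ} (hq : Continuous q) : IsRegular X fun t => q (t, sigma X t) where
  bounded := by
    have hc : IsCompact X := Metric.isCompact_of_isClosed_isBounded hX
      ((Metric.isBounded_Icc a b).subset fun x hx => ⟨ha.2 hx, hb.2 hx⟩)
    obtain ⟨C, hC⟩ := (hc.prod hc).exists_bound_of_continuousOn hq.continuousOn
    have h : ∀ t ∈ X, |q (t, sigma X t)| ≤ C := fun t ht => hC _ ⟨ht, sigma_mem hX ht⟩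
    exact ⟨C, (abs_nonneg _).trans (h a ha.1), h⟩
  cont t ht h := by
    have := (continuousWithinAt_id (s := X) (x := t)).prodMk (continuousWithinAt_sigma hb ht h)
    exact hq.continuousAt.comp_continuousWithinAt this
  meas := hq.measurable.comp ((measurable_floor ha).prodMk
    ((sigma_mono X).measurable.comp (measurable_floor ha)))

theorem isRegular_of_continuous (hX : IsClosed X) (ha : IsLeast X a) (hb : IsGreatest X b)
    (hp : Continuous p) : IsRegular X p :=
  isRegular_sigma hX ha hb (q := fun x => p x.1) (hp.comp continuous_fst)

theorem IsRegular.sub {q : ℝ → ℝ} (hp : IsRegular X p) (hq : IsRegular X q) :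
    IsRegular X fun t => p t - q t where
  bounded := by
    obtain ⟨C, hC0, hC⟩ := hp.bounded
    obtain ⟨D, hD0, hD⟩ := hq.bounded
    exact ⟨C + D, by positivity, fun t ht => (abs_sub _ _).trans (add_le_add (hC t ht) (hD t ht))⟩
  cont t ht h := (hp.cont t ht h).sub (hq.cont t ht h)
  meas := hp.meas.sub hq.meas

theorem IsRegular.exists_bound_floor (hX : IsClosed X) (ha : IsLeast X a) (hp : IsRegular X p) :
    ∃ C, 0 ≤ C ∧ ∀ t, |p (floor X t)| ≤ C := by
  obtain ⟨C, hC0, hC⟩ := hp.bounded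
  -- To the left of `a` the value of `floor X` is the default `0`, which need not lie in `X`.
  refine ⟨max C |p 0|, hC0.trans (le_max_left _ _), fun t => ?_⟩
  rcases lt_or_ge t a with h | h
  · rw [floor_of_lt ha h]; exact le_max_right _ _
  · exact (hC _ (floor_mem hX ha h)).trans (le_max_left _ _)

theorem IsRegular.intervalIntegrable (hX : IsClosed X) (ha : IsLeast X a) (hp : IsRegular X p)
    (r s : ℝ) : IntervalIntegrable (fun t => p (floor X t)) volume r s := by
  obtain ⟨C, -, hC⟩ := hp.exists_bound_floor hX ha
  exact (intervalIntegrable_const (c := C)).mono_fun' hp.meas.aestronglyMeasurable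
    (Eventually.of_forall hC)

theorem primitive_sub (hX : IsClosed X) (ha : IsLeast X a) (hp : IsRegular X p) (r s : ℝ) :
    primitive X a p s - primitive X a p r = ∫ t in r..s, p (floor X t) :=
  intervalIntegral.integral_interval_sub_left (hp.intervalIntegrable hX ha _ _)
    (hp.intervalIntegrable hX ha _ _)

theorem primitive_sub_mul (hX : IsClosed X) (ha : IsLeast X a) (hp : IsRegular X p) (r s c : ℝ) :
    primitive X a p s - primitive X a p r - c * (s - r) = ∫ t in r..s, (p (floor X t) - c) := by
  rw [primitive_sub hX ha hp, intervalIntegral.integral_sub (hp.intervalIntegrable hX ha _ _)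
    intervalIntegrable_const, intervalIntegral.integral_const, smul_eq_mul, mul_comm c]

theorem continuous_primitive (hX : IsClosed X) (ha : IsLeast X a) (hp : IsRegular X p) :
    Continuous (primitive X a p) :=
  intervalIntegral.continuous_primitive (hp.intervalIntegrable hX ha) a

theorem primitive_sigma (hX : IsClosed X) (ha : IsLeast X a) (hp : IsRegular X p) (ht : t ∈ X) :
    primitive X a p (sigma X t) - primitive X a p t - p t * (sigma X t - t) = 0 := by
  rw [primitive_sub_mul hX ha hp]
  refine intervalIntegral.integral_zero_ae ?_
  filter_upwards [compl_mem_ae_iff.2 (measure_singleton (sigma X t))] with x hx hxI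
  rw [uIoc_of_le (le_sigma X t)] at hxI
  rw [floor_eq_of_lt_sigma hX ha ht hxI.1.le (lt_of_le_of_ne hxI.2 hx), sub_self]

/-- For `x` between `s` and `t` the point `floor X x` also lies between them, so the integrand stays
within `ε` of `p t`. -/
theorem primitive_isLittleO (hX : IsClosed X) (ha : IsLeast X a) (hp : IsRegular X p)
    (ht : t ∈ X) (hc : ContinuousWithinAt p X t) {ε : ℝ} (hε : 0 < ε) :
    ∃ δ > 0, ∀ s ∈ X, |s - t| < δ →
      |primitive X a p t - primitive X a p s - p t * (t - s)| ≤ ε * |t - s| := by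
  obtain ⟨δ, hδ, H⟩ := Metric.continuousWithinAt_iff.1 hc ε hε
  refine ⟨δ, hδ, fun s hs hst => ?_⟩
  rw [primitive_sub_mul hX ha hp, ← Real.norm_eq_abs]
  refine intervalIntegral.norm_integral_le_of_norm_le_const (C := ε) fun x hx => ?_
  have hax : a ≤ x := (le_min (ha.2 hs) (ha.2 ht)).trans hx.1.le
  have h1 := floor_mem hX ha hax
  refine (H h1 ?_).le
  rw [Real.dist_eq]
  refine lt_of_le_of_lt ?_ hst
  have h2 := floor_le ha hax
  rcases le_total s t with h | h
  · rw [uIoc_of_le h] at hx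
    have h3 := le_floor hs hx.1.le
    rw [abs_of_nonpos (by linarith [hx.2]), abs_of_nonpos (by linarith)]
    linarith
  · rw [uIoc_of_ge h] at hx
    have h3 := le_floor ht hx.1.le
    rw [abs_of_nonneg (by linarith), abs_of_nonneg (by linarith)]
    linarith [hx.2]

theorem hasDeltaDeriv_primitive (hX : IsClosed X) (ha : IsLeast X a) (hb : IsGreatest X b)
    (hp : IsRegular X p) (ht : t ∈ kappaUp X) :
    HasDeltaDeriv X (primitive X a p) t (p t) := by
  refine ⟨ht, fun ε hε => ?_⟩
  have htX := ((mem_kappaUp hb).1 ht).1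
  rcases (le_sigma X t).eq_or_lt with he | hlt
  · rw [← he]
    exact primitive_isLittleO hX ha hp htX (hp.cont t htX he.symm) hε
  · have hC := (continuous_primitive hX ha hp).continuousAt (x := t)
    set μ := sigma X t - t with hμ
    have hμ0 : 0 < μ := by linarith
    have hc : ContinuousAt (fun s => |primitive X a p t - primitive X a p s - p t * (t - s)|) t := by
      fun_prop
    have hev : ∀ᶠ s in 𝓝 t, |primitive X a p t - primitive X a p s - p t * (t - s)| < ε * μ := by
      refine hc.eventually_lt continuousAt_const ?_
      simp; positivity
    obtain ⟨δ, hδ, H⟩ := Metric.eventually_nhds_iff.1 hev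
    -- At a right-scattered `t` the gap contributes exactly `p t * μ`, and nearby points `s` of `X`
    -- satisfy `s ≤ t`, hence `μ ≤ σ t - s`. Continuity of the primitive is then enough; `p` need
    -- not be continuous at `t`.
    refine ⟨min δ μ, lt_min hδ hμ0, fun s hs hst => ?_⟩
    have h1 := H (show dist s t < δ from hst.trans_le (min_le_left _ _))
    have h2 : s ≤ t := le_of_lt_sigma hs (by
      have := (abs_lt.1 (hst.trans_le (min_le_right _ _))).2; linarith)
    have h3 := primitive_sigma hX ha hp htX
    have h4 : primitive X a p (sigma X t) - primitive X a p s - p t * (sigma X t - s) =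
        primitive X a p t - primitive X a p s - p t * (t - s) := by linarith
    rw [h4]
    refine h1.le.trans ?_
    gcongr
    rw [abs_of_nonneg (by linarith)]; linarith

theorem isRegular_primitive (hX : IsClosed X) (ha : IsLeast X a) (hb : IsGreatest X b)
    (hp : IsRegular X p) : IsRegular X (primitive X a p) :=
  isRegular_of_continuous hX ha hb (continuous_primitive hX ha hp)

end regular

/-! ### Test functions -/

/-- Continuous functions taking the same value at the two ends of every gap of `X` whose right
end is right-dense or maximal. Their primitives belong to `C¹_◇`. -/
structure IsTestFunction (X : Set ℝ) (k : ℝ → ℝ) : Prop where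
  cont : Continuous k
  gap : ∀ s ∈ X, sigma X (sigma X s) = sigma X s → k (sigma X s) = k s

section test

variable {X : Set ℝ} {a b t : ℝ} {k : ℝ → ℝ}

theorem IsTestFunction.sub_const (hk : IsTestFunction X k) (c : ℝ) :
    IsTestFunction X fun t => k t - c :=
  ⟨hk.cont.sub continuous_const, fun s hs h => by rw [hk.gap s hs h]⟩

theorem IsTestFunction.eq_rho (hX : IsClosed X) (hk : IsTestFunction X k) (ht : t ∈ X)
    (h : rho X t < t) (hσ : sigma X t = t) : k (rho X t) = k t := by
  have h1 := sigma_rho ht h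
  have := hk.gap (rho X t) (rho_mem hX ht) (by rw [h1, hσ])
  rw [h1] at this
  exact this.symm

/-- The critical point is a left-scattered, right-dense `t`: there `ρ s → t` as `s ↓ t` while `ρ t <
t`, so `k ∘ ρ` would jump without the condition `gap`. -/
theorem IsTestFunction.continuousOn_rho (hX : IsClosed X) (ha : IsLeast X a)
    (hk : IsTestFunction X k) : ContinuousOn (fun t => k (rho X t)) X := by
  intro t ht
  rcases (rho_le X t).eq_or_lt with he | hlt
  · exact hk.cont.continuousAt.comp_continuousWithinAt (continuousWithinAt_rho ha ht he)
  rw [Metric.continuousWithinAt_iff]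
  intro ε hε
  rcases (le_sigma X t).eq_or_lt with hσ | hσ
  · obtain ⟨δ, hδ, H⟩ := Metric.continuousAt_iff.1 (hk.cont.continuousAt (x := t)) ε hε
    refine ⟨min δ (t - rho X t), lt_min hδ (by linarith), fun s hs hst => ?_⟩
    obtain ⟨h1, h2⟩ := lt_min_iff.1 hst
    rw [Real.dist_eq, abs_lt] at h1 h2
    have hts : t ≤ s := ge_of_rho_lt hs (by linarith)
    rcases hts.eq_or_lt with rfl | hts
    · simpa using hε
    · rw [hk.eq_rho hX ht hlt hσ.symm]
      apply H
      rw [Real.dist_eq, abs_lt]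
      have := le_rho ht hts
      have := rho_le X s
      constructor <;> linarith
  · refine ⟨min (sigma X t - t) (t - rho X t), lt_min (by linarith) (by linarith),
      fun s hs hst => ?_⟩
    obtain ⟨h1, h2⟩ := lt_min_iff.1 hst
    rw [Real.dist_eq, abs_lt] at h1 h2
    have : s = t := le_antisymm (le_of_lt_sigma hs (by linarith)) (ge_of_rho_lt hs (by linarith))
    simpa [this] using hε

theorem IsTestFunction.hasNablaDeriv_primitive (hX : IsClosed X) (ha : IsLeast X a)
    (hb : IsGreatest X b) (hk : IsTestFunction X k) (ht : t ∈ kappaDown X) :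
    HasNablaDeriv X (primitive X a k) t (k (rho X t)) := by
  have hr := isRegular_of_continuous hX ha hb hk.cont
  refine ⟨ht, fun ε hε => ?_⟩
  have htX := ((mem_kappaDown ha).1 ht).1
  obtain ⟨δ, hδ, H⟩ := primitive_isLittleO hX ha hr htX hk.cont.continuousWithinAt hε
  rcases (rho_le X t).eq_or_lt with he | hlt
  · rw [he]
    exact ⟨δ, hδ, H⟩
  have hgap := primitive_sigma hX ha hr (rho_mem hX htX)
  rw [sigma_rho htX hlt] at hgap
  have key : ∀ s, primitive X a k (rho X t) - primitive X a k s - k (rho X t) * (rho X t - s) =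
      primitive X a k t - primitive X a k s - k (rho X t) * (t - s) := fun s => by linarith
  -- By `key` the nabla quotient may be based at `t` with slope `k (ρ t)`. If `t` is right-dense or
  -- maximal, this slope is `k t`; otherwise `t` is isolated.
  rcases (le_sigma X t).eq_or_lt with hσ | hσ
  · refine ⟨min δ (t - rho X t), lt_min hδ (by linarith), fun s hs hst => ?_⟩
    obtain ⟨h1, h2⟩ := lt_min_iff.1 hst
    have hts : t ≤ s := ge_of_rho_lt hs (by linarith [(abs_lt.1 h2).1])
    rw [key, hk.eq_rho hX htX hlt hσ.symm]
    refine (H s hs h1).trans ?_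
    gcongr ε * ?_
    rw [abs_of_nonpos (by linarith), abs_of_nonpos (by linarith)]
    linarith
  · refine ⟨min (sigma X t - t) (t - rho X t), lt_min (by linarith) (by linarith),
      fun s hs hst => ?_⟩
    obtain ⟨h1, h2⟩ := lt_min_iff.1 hst
    have : s = t := le_antisymm (le_of_lt_sigma hs (by linarith [(abs_lt.1 h1).2]))
      (ge_of_rho_lt hs (by linarith [(abs_lt.1 h2).1]))
    subst this
    rw [key]
    simp; positivity

theorem IsTestFunction.c1Diamond_primitive (hX : IsClosed X) (ha : IsLeast X a)
    (hb : IsGreatest X b) (hab : a < b) (hk : IsTestFunction X k) :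
    C1Diamond X (primitive X a k) where
  delta_exists _ ht :=
    ⟨_, hasDeltaDeriv_primitive hX ha hb (isRegular_of_continuous hX ha hb hk.cont) ht⟩
  nabla_exists _ ht := ⟨_, hk.hasNablaDeriv_primitive hX ha hb ht⟩
  delta_cont := hk.cont.continuousOn.congr fun _ ht => (hasDeltaDeriv_primitive hX ha hb
    (isRegular_of_continuous hX ha hb hk.cont) ht).deltaDeriv_eq ha hb hab
  nabla_cont := ((hk.continuousOn_rho hX ha).mono fun _ ht => ((mem_kappaDown ha).1 ht).1).congr
    fun _ ht => (hk.hasNablaDeriv_primitive hX ha hb ht).nablaDeriv_eq ha hb hab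

end test

/-! ### The lemma of Du Bois-Reymond -/

section duBoisReymond

variable {X : Set ℝ} {a b t : ℝ} {p g k : ℝ → ℝ}

/-- The gap after `t` carries the value at `t`, so up to the single point `σ t` the condition `floor
X s ≤ t` means `s ≤ σ t`. -/
theorem integral_ite_floor_le (hX : IsClosed X) (ha : IsLeast X a) (hb : IsGreatest X b)
    (ht : t ∈ X) (F : ℝ → ℝ) :
    ∫ s in a..b, (if floor X s ≤ t then F s else 0) = ∫ s in a..sigma X t, F s := by
  have hab : a ≤ b := ha.2 hb.1
  have hσ := sigma_mem hX ht
  have hS : MeasurableSet {s | floor X s ≤ t} := measurableSet_le (measurable_floor ha)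
    measurable_const
  rw [intervalIntegral.integral_of_le hab, intervalIntegral.integral_of_le (ha.2 hσ)]
  have : (fun s => if floor X s ≤ t then F s else 0) = {s | floor X s ≤ t}.indicator F := by
    funext s; simp [indicator]
  rw [this, setIntegral_indicator hS]
  refine setIntegral_congr_set ?_
  filter_upwards [compl_mem_ae_iff.2 (measure_singleton (sigma X t))] with x hx
  refine propext ⟨fun h => ⟨h.1.1, ?_⟩, fun h => ⟨⟨h.1, h.2.trans (hb.2 hσ)⟩, ?_⟩⟩
  · by_contra hc
    have hlt := not_le.1 hc
    have htb : t < b := ((le_sigma X t).trans_lt hlt).trans_le h.1.2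
    exact absurd (show floor X x ≤ t from h.2)
      (not_le.2 (lt_floor_of_sigma_lt hX hb ht htb hlt))
  · exact floor_le_of_lt_sigma hX ha h.1.le (lt_of_le_of_ne h.2 hx)

theorem integral_ite_le_floor (ha : IsLeast X a) (ht : t ∈ X) (htb : t ≤ b) (F : ℝ → ℝ) :
    ∫ s in a..b, (if t ≤ floor X s then F s else 0) = ∫ s in t..b, F s := by
  have hS : MeasurableSet {s | t ≤ floor X s} := measurableSet_le measurable_const
    (measurable_floor ha)
  rw [intervalIntegral.integral_of_le ((ha.2 ht).trans htb), intervalIntegral.integral_of_le htb]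
  have : (fun s => if t ≤ floor X s then F s else 0) = {s | t ≤ floor X s}.indicator F := by
    funext s; simp [indicator]
  rw [this, setIntegral_indicator hS]
  refine setIntegral_congr_set ?_
  filter_upwards [compl_mem_ae_iff.2 (measure_singleton t)] with x hx
  refine propext ⟨fun h => ⟨?_, h.1.2⟩, fun h => ⟨⟨(ha.2 ht).trans_lt h.1, h.2⟩, ?_⟩⟩
  · exact lt_of_le_of_ne ((le_floor_iff ha ht h.1.1.le).1 h.2) (Ne.symm hx)
  · exact le_floor ht h.1.le

/-- Integration by parts on the time scale. -/
theorem integral_mul_primitive_sigma (hX : IsClosed X) (ha : IsLeast X a) (hb : IsGreatest X b)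
    (hp : IsRegular X p) (hk : IsRegular X k) :
    ∫ s in a..b, p (floor X s) * primitive X a k (sigma X (floor X s)) =
      ∫ s in a..b, k (floor X s) * (primitive X a p b - primitive X a p (floor X s)) := by
  have hab : a ≤ b := ha.2 hb.1
  -- Both sides are iterated integrals of this kernel: integrating over `r` gives the primitive of
  -- `k` at `σ`, and integrating over `s` gives the tail of the primitive of `p`.
  set K : ℝ → ℝ → ℝ := fun s r =>
    if floor X r ≤ floor X s then p (floor X s) * k (floor X r) else 0 with hK
  have h1 : ∫ s in a..b, p (floor X s) * primitive X a k (sigma X (floor X s)) =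
      ∫ s in a..b, ∫ r in a..b, K s r := by
    refine intervalIntegral.integral_congr fun s hs => ?_
    rw [uIcc_of_le hab] at hs
    simp only [hK]
    rw [integral_ite_floor_le hX ha hb (floor_mem hX ha hs.1), primitive,
      intervalIntegral.integral_const_mul]
  have h2 : ∫ r in a..b, k (floor X r) * (primitive X a p b - primitive X a p (floor X r)) =
      ∫ r in a..b, ∫ s in a..b, K s r := by
    refine intervalIntegral.integral_congr fun r hr => ?_
    rw [uIcc_of_le hab] at hr
    have hm := floor_mem hX ha hr.1
    simp only [hK]
    rw [integral_ite_le_floor ha hm (hb.2 hm), primitive_sub hX ha hp,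
      intervalIntegral.integral_mul_const, mul_comm]
  rw [h1, h2]
  simp only [intervalIntegral.integral_of_le hab]
  refine integral_integral_swap (f := K) ?_
  obtain ⟨C, hC0, hC⟩ := hp.exists_bound_floor hX ha
  obtain ⟨D, hD0, hD⟩ := hk.exists_bound_floor hX ha
  refine Integrable.of_bound (C := C * D) ?_ (Eventually.of_forall fun z => ?_)
  · refine Measurable.aestronglyMeasurable (Measurable.ite ?_ ?_ measurable_const)
    · exact measurableSet_le ((measurable_floor ha).comp measurable_snd)
        ((measurable_floor ha).comp measurable_fst)
    · exact (hp.meas.comp measurable_fst).mul (hk.meas.comp measurable_snd)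
  · simp only [Function.uncurry, hK]
    split_ifs
    · rw [Real.norm_eq_abs, abs_mul]
      exact mul_le_mul (hC _) (hD _) (abs_nonneg _) hC0
    · simp; positivity

/-- The gaps of `X` whose right end is right-dense or maximal. -/
def tightGaps (X : Set ℝ) : Set (ℝ × ℝ) :=
  {p | p.1 ∈ X ∧ p.2 = sigma X p.1 ∧ p.1 < p.2 ∧ sigma X p.2 = p.2}

/-- Two different gaps can share only an endpoint, the right end of one being the left end of the
other; but no gap starts at a right-dense or maximal point. -/
theorem tightGaps_disjoint (p) (hp : p ∈ tightGaps X) (q) (hq : q ∈ tightGaps X)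
    (h : (Icc p.1 p.2 ∩ Icc q.1 q.2).Nonempty) : p = q := by
  have aux : ∀ p ∈ tightGaps X, ∀ q ∈ tightGaps X, ∀ x, x ∈ Icc p.1 p.2 → x ∈ Icc q.1 q.2 →
      ¬ p.1 < q.1 := by
    intro p hp q hq x hxp hxq hlt
    have h1 : p.2 ≤ q.1 := hp.2.1 ▸ sigma_le hq.1 hlt
    have h2 : q.1 = p.2 := le_antisymm (hxq.1.trans hxp.2) h1
    have h3 : q.2 = q.1 := by rw [hq.2.1, h2, hp.2.2.2]
    exact absurd hq.2.2.1 (by rw [h3]; exact lt_irrefl _)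
  obtain ⟨x, hxp, hxq⟩ := h
  have h1 : p.1 = q.1 := le_antisymm (not_lt.1 (aux q hq p hp x hxq hxp))
    (not_lt.1 (aux p hp q hq x hxp hxq))
  exact Prod.ext h1 (by rw [hp.2.1, hq.2.1, h1])

/-- Only a tight gap with left end `q` could straddle `q`. The first alternative leaves no gap
there, and under the second that gap is not tight. -/
theorem saturated_Iic {q : ℝ} (hq : sigma X q = q ∨ sigma X (sigma X q) ≠ sigma X q)
    (hqX : q ∈ X) : Saturated (tightGaps X) (Iic q) := by
  rintro p hp ⟨x, hxp, hxq⟩ y hy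
  by_contra hc
  have hlt : q < p.2 := (not_le.1 hc).trans_le hy.2
  have h1 : q ≤ p.1 := by
    refine le_of_lt_sigma hqX ?_
    rw [← hp.2.1]; exact hlt
  have h2 : p.1 = q := le_antisymm (hxp.1.trans hxq) h1
  have h3 := hp.2.1
  rw [h2] at h3
  have h4 := hp.2.2.2
  rw [h3] at h4 hlt
  rcases hq with h | h
  · exact hlt.ne' h
  · exact h h4

theorem exists_testFunction_cutoff {q : ℝ}
    (hq : sigma X q = q ∨ sigma X (sigma X q) ≠ sigma X q) (hqX : q ∈ X) {r : ℝ} (hr : q < r) :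
    ∃ k : ℝ → ℝ, IsTestFunction X k ∧ (∀ x ≤ q, k x = 1) ∧ (∀ x, r ≤ x → k x = 0) ∧
      ∀ x, |k x| ≤ 1 := by
  obtain ⟨k, hk, h1, h0, h01, hJ⟩ := exists_continuous_const_on_intervals
    (tightGaps_disjoint (X := X)) isClosed_Iic (saturated_Iic hq hqX) (isClosed_Ici (a := r))
    (disjoint_left.2 fun x hx hx' => absurd (le_trans hx' hx) (not_le.2 hr))
  refine ⟨k, ⟨hk, fun s hs h => ?_⟩, h1, h0, fun x => abs_le.2 ⟨by linarith [(h01 x).1],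
    (h01 x).2⟩⟩
  rcases (le_sigma X s).eq_or_lt with he | hlt
  · rw [← he]
  · exact hJ (s, sigma X s) ⟨hs, rfl, hlt, h⟩ _ ⟨hlt.le, le_rfl⟩ _ ⟨le_rfl, hlt.le⟩

theorem primitive_sigma_eq_zero (hX : IsClosed X) (ha : IsLeast X a) (hb : IsGreatest X b)
    (hg : IsRegular X g)
    (H : ∀ k, IsTestFunction X k → ∫ s in a..b, g (floor X s) * k (floor X s) = 0)
    (ht : t ∈ X) : primitive X a g (sigma X t) = 0 := by
  -- If the gap after `t` is tight, no test function can cut inside it, so the cut is moved to its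
  -- right end, which has the same `σ`.
  obtain ⟨q, hqX, hqt, hq⟩ : ∃ q ∈ X, sigma X q = sigma X t ∧
      (sigma X q = q ∨ sigma X (sigma X q) ≠ sigma X q) := by
    by_cases h : sigma X (sigma X t) = sigma X t
    · exact ⟨sigma X t, sigma_mem hX ht, h, Or.inl h⟩
    · exact ⟨t, ht, rfl, Or.inr h⟩
  have hn : ∀ n : ℕ, q < q + 1 / ((n : ℝ) + 1) := fun n => by
    have : (0 : ℝ) < 1 / ((n : ℝ) + 1) := by positivity
    linarith
  choose k hk h1 h0 hb1 using fun n : ℕ => exists_testFunction_cutoff hq hqX (hn n)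
  rw [← hqt, primitive, ← integral_ite_floor_le hX ha hb hqX]
  have hlim : Tendsto (fun n => ∫ s in a..b, g (floor X s) * k n (floor X s)) atTop
      (𝓝 (∫ s in a..b, (if floor X s ≤ q then g (floor X s) else 0))) := by
    refine intervalIntegral.tendsto_integral_filter_of_dominated_convergence
      (fun s => |g (floor X s)|) (Eventually.of_forall fun n => ?_)
      (Eventually.of_forall fun n => Eventually.of_forall fun s _ => ?_)
      (hg.intervalIntegrable hX ha a b).abs (Eventually.of_forall fun s _ => ?_)
    · exact (hg.meas.mul ((hk n).cont.measurable.comp (measurable_floor ha))).aestronglyMeasurable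
    · rw [Real.norm_eq_abs, abs_mul]
      exact mul_le_of_le_one_right (abs_nonneg _) (hb1 n _)
    · refine tendsto_const_nhds.congr' ?_
      split_ifs with h
      · exact Eventually.of_forall fun n => by simp [h1 n _ h]
      · have hev := (tendsto_one_div_add_atTop_nhds_zero_nat (𝕜 := ℝ)).eventually_lt_const
          (sub_pos.2 (not_le.1 h))
        filter_upwards [hev] with n hn
        simp [h0 n (floor X s) (by linarith)]
  refine tendsto_nhds_unique hlim ?_
  simp only [H _ (hk _)]
  exact tendsto_const_nhds

/-- A left-scattered `t` is `σ (ρ t)`. A left-dense `t > a` is a limit of values `σ s` with `s < t`,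
and the primitive is continuous. -/
theorem primitive_eq_zero (hX : IsClosed X) (ha : IsLeast X a) (hb : IsGreatest X b)
    (hg : IsRegular X g)
    (H : ∀ k, IsTestFunction X k → ∫ s in a..b, g (floor X s) * k (floor X s) = 0)
    (ht : t ∈ X) : primitive X a g t = 0 := by
  have hσ : ∀ s ∈ X, primitive X a g (sigma X s) = 0 := fun s hs =>
    primitive_sigma_eq_zero hX ha hb hg H hs
  rcases (rho_le X t).eq_or_lt with he | hlt
  · rcases (ha.2 ht).eq_or_lt with rfl | hat
    · simp [primitive]
    by_contra hne
    obtain ⟨ε, hε, hball⟩ := Metric.eventually_nhds_iff.1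
      ((continuous_primitive hX ha hg).continuousAt.eventually_ne hne)
    obtain ⟨s, hs, h1, h2⟩ := exists_lt_of_rho_eq ha.1 hat he (sub_lt_self t hε)
    refine hball ?_ (hσ s hs)
    have h3 := sigma_le ht h2
    have h4 := le_sigma X s
    rw [Real.dist_eq, abs_lt]
    constructor <;> linarith
  · rw [← sigma_rho ht hlt]
    exact hσ _ (rho_mem hX ht)

theorem eq_zero_of_integral_mul_testFunction (hX : IsClosed X) (ha : IsLeast X a)
    (hb : IsGreatest X b) (hab : a < b) (hg : IsRegular X g)
    (H : ∀ k, IsTestFunction X k → ∫ s in a..b, g (floor X s) * k (floor X s) = 0)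
    (ht : t ∈ kappaUp X) : g t = 0 := by
  refine (hasDeltaDeriv_primitive hX ha hb hg ht).unique ha hb hab ⟨ht, fun ε hε =>
    ⟨1, one_pos, fun s hs _ => ?_⟩⟩
  rw [primitive_eq_zero hX ha hb hg H (sigma_mem hX ((mem_kappaUp hb).1 ht).1),
    primitive_eq_zero hX ha hb hg H hs]
  simp; positivity

theorem duBoisReymond {f : ℝ → ℝ} (hX : IsClosed X) (ha : IsLeast X a)
    (hb : IsGreatest X b) (hab : a < b) (hf : IsRegular X f) (hp : IsRegular X p)
    (H : ∀ k, IsTestFunction X k → ∫ s in a..b, k (floor X s) = 0 →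
      ∫ s in a..b, (p (floor X s) * primitive X a k (sigma X (floor X s)) +
        f (floor X s) * k (floor X s)) = 0) :
    ∃ c, ∀ t ∈ kappaUp X, f t = c + primitive X a p t := by
  have hG := isRegular_primitive hX ha hb hp
  have hg := hf.sub hG
  have hint : ∀ {u v : ℝ → ℝ}, IsRegular X u → IsRegular X v →
      IntervalIntegrable (fun s => u (floor X s) * v (floor X s)) volume a b := by
    intro u v hu hv
    obtain ⟨C, hC0, hC⟩ := hu.exists_bound_floor hX ha
    obtain ⟨D, hD0, hD⟩ := hv.exists_bound_floor hX ha
    refine (intervalIntegrable_const (c := C * D)).mono_fun'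
      (hu.meas.mul hv.meas).aestronglyMeasurable (Eventually.of_forall fun s => ?_)
    beta_reduce
    rw [Real.norm_eq_abs, abs_mul]
    exact mul_le_mul (hC _) (hD _) (abs_nonneg _) hC0
  have h1 : ∀ k, IsTestFunction X k → ∫ s in a..b, k (floor X s) = 0 →
      ∫ s in a..b, (f (floor X s) - primitive X a p (floor X s)) * k (floor X s) = 0 := by
    intro k hk hk0
    have hkr := isRegular_of_continuous hX ha hb hk.cont
    have hη : IsRegular X fun t => primitive X a k (sigma X t) :=
      isRegular_sigma hX ha hb (q := fun x => primitive X a k x.2)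
        ((continuous_primitive hX ha hkr).comp continuous_snd)
    have := H k hk hk0
    rw [intervalIntegral.integral_add (hint hp hη) (hint hf hkr),
      integral_mul_primitive_sigma hX ha hb hp hkr] at this
    simp only [mul_sub, sub_mul] at this ⊢
    rw [intervalIntegral.integral_sub ((hkr.intervalIntegrable hX ha a b).mul_const _)
      (hint hkr hG), intervalIntegral.integral_mul_const, hk0, zero_mul] at this
    rw [intervalIntegral.integral_sub (hint hf hkr) (hint hG hkr)]
    simp only [mul_comm (k _)] at this
    linarith
  set G : ℝ → ℝ := fun t => f t - primitive X a p t with hGdef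
  -- `c` is the mean of `G`. Subtracting its mean `m` from an arbitrary test function makes `h1`
  -- applicable, and `∫ G (k - m) = ∫ (G - c) k`.
  set c := (∫ s in a..b, G (floor X s)) / (b - a) with hc
  have hba : b - a ≠ 0 := (sub_pos.2 hab).ne'
  have hcst : IsRegular X fun _ => c := isRegular_of_continuous hX ha hb continuous_const
  refine ⟨c, fun t ht => ?_⟩
  have h2 : ∀ k, IsTestFunction X k →
      ∫ s in a..b, (G (floor X s) - c) * k (floor X s) = 0 := by
    intro k hk
    have hkr := isRegular_of_continuous hX ha hb hk.cont
    set m := (∫ s in a..b, k (floor X s)) / (b - a) with hm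
    have h3 := h1 _ (hk.sub_const m) (by
      rw [intervalIntegral.integral_sub (hkr.intervalIntegrable hX ha a b)
        intervalIntegrable_const, intervalIntegral.integral_const, smul_eq_mul, hm]
      field_simp; ring)
    simp only [mul_sub, sub_mul] at h3 ⊢
    simp only [← sub_mul] at h3
    rw [intervalIntegral.integral_sub (hint hg hkr) ((hg.intervalIntegrable hX ha a b).mul_const _),
      intervalIntegral.integral_mul_const] at h3
    rw [intervalIntegral.integral_sub (hint hg hkr) ((hkr.intervalIntegrable hX ha a b).const_mul _),
      intervalIntegral.integral_const_mul]
    have h4 : (∫ s in a..b, G (floor X s)) * m = c * ∫ s in a..b, k (floor X s) := by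
      rw [hc, hm]; ring
    rw [← h4]
    exact h3
  have := eq_zero_of_integral_mul_testFunction hX ha hb hab (hg.sub hcst) h2 ht
  simp only [hGdef] at this
  linarith

end duBoisReymond

/-! ### The first variation -/

/-- For fixed `t`, continuous partial derivatives in the last two variables give joint strict
differentiability, and the chain rule applies. -/
theorem SmoothLagrangian.hasDerivAt_line {X : Set ℝ} {M : ℝ → ℝ → ℝ → ℝ}
    (hM : SmoothLagrangian X M) {t : ℝ} (ht : t ∈ X) (x v α β e : ℝ) :
    HasDerivAt (fun e => M t (x + e * α) (v + e * β))
      (partial2 M t (x + e * α) (v + e * β) * α + partial3 M t (x + e * α) (v + e * β) * β) e := by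
  set f₁ : ℝ → ℝ → ℝ →L[ℝ] ℝ := fun x v => ContinuousLinearMap.toSpanSingleton ℝ (partial2 M t x v)
  set f₂ : ℝ → ℝ → ℝ →L[ℝ] ℝ := fun x v => ContinuousLinearMap.toSpanSingleton ℝ (partial3 M t x v)
  have hline : Continuous fun p : ℝ × ℝ => (t, p.1, p.2) := by fun_prop
  have hmem : ∀ p : ℝ × ℝ, (t, p.1, p.2) ∈ X ×ˢ (univ : Set (ℝ × ℝ)) := fun p => ⟨ht, mem_univ _⟩
  have c1 : Continuous fun p : ℝ × ℝ => partial2 M t p.1 p.2 :=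
    hM.cont2.comp_continuous hline hmem
  have c2 : Continuous fun p : ℝ × ℝ => partial3 M t p.1 p.2 :=
    hM.cont3.comp_continuous hline hmem
  have hstrict := hasStrictFDerivAt_uncurry_coprod (𝕜 := ℝ) (u := (x + e * α, v + e * β))
    (f := M t) (f₁ := f₁) (f₂ := f₂)
    (Eventually.of_forall fun p => (hM.diff2 t ht p.1 p.2).hasDerivAt.hasFDerivAt)
    (Eventually.of_forall fun p => (hM.diff3 t ht p.1 p.2).hasDerivAt.hasFDerivAt)
    ((ContinuousLinearMap.toSpanSingletonCLE (𝕜 := ℝ) (E := ℝ)).continuous.comp c1).continuousAt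
    ((ContinuousLinearMap.toSpanSingletonCLE (𝕜 := ℝ) (E := ℝ)).continuous.comp c2).continuousAt
  have hg : HasDerivAt (fun e : ℝ => (x + e * α, v + e * β)) (α, β) e := by
    refine HasDerivAt.prodMk ?_ ?_
    · simpa using ((hasDerivAt_id e).mul_const α).const_add x
    · simpa using ((hasDerivAt_id e).mul_const β).const_add v
  have := hstrict.hasFDerivAt.comp_hasDerivAt e hg
  refine this.congr_deriv ?_
  simp [f₁, f₂, Function.HasUncurry.uncurry, mul_comm]

/-- Treating `σ t` as a separate variable lets `Φ` and `Φ'` be continuous although `σ` is not;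
compactness of `[-1, 1] × X × X` then supplies the dominating constant. -/
theorem hasDerivAt_integral_floor {X : Set ℝ} {a b : ℝ} (hX : IsClosed X) (ha : IsLeast X a)
    (hb : IsGreatest X b) {Φ Φ' : ℝ × ℝ × ℝ → ℝ} (hΦ : Continuous Φ) (hΦ' : Continuous Φ')
    (h : ∀ t ∈ X, ∀ s e, HasDerivAt (fun e => Φ (e, t, s)) (Φ' (e, t, s)) e) :
    HasDerivAt (fun e => ∫ r in a..b, Φ (e, floor X r, sigma X (floor X r)))
      (∫ r in a..b, Φ' (0, floor X r, sigma X (floor X r))) 0 := by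
  have hab : a ≤ b := ha.2 hb.1
  have hc : IsCompact X := Metric.isCompact_of_isClosed_isBounded hX
    ((Metric.isBounded_Icc a b).subset fun x hx => ⟨ha.2 hx, hb.2 hx⟩)
  obtain ⟨C, hC⟩ := ((isCompact_closedBall (0 : ℝ) 1).prod (hc.prod hc)).exists_bound_of_continuousOn
    hΦ'.continuousOn
  have hreg : ∀ e, IsRegular X fun t => Φ (e, t, sigma X t) := fun e =>
    isRegular_sigma hX ha hb (q := fun p => Φ (e, p.1, p.2)) (by fun_prop)
  have hreg' : ∀ e, IsRegular X fun t => Φ' (e, t, sigma X t) := fun e =>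
    isRegular_sigma hX ha hb (q := fun p => Φ' (e, p.1, p.2)) (by fun_prop)
  have hmem : ∀ r ∈ uIoc a b, floor X r ∈ X := fun r hr => by
    rw [uIoc_of_le hab] at hr
    exact floor_mem hX ha hr.1.le
  exact (intervalIntegral.hasDerivAt_integral_of_dominated_loc_of_deriv_le
    (F := fun e r => Φ (e, floor X r, sigma X (floor X r)))
    (F' := fun e r => Φ' (e, floor X r, sigma X (floor X r)))
    (bound := fun _ => C) (Metric.ball_mem_nhds (0 : ℝ) one_pos)
    (Eventually.of_forall fun e => (hreg e).meas.aestronglyMeasurable)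
    ((hreg 0).intervalIntegrable hX ha a b) (hreg' 0).meas.aestronglyMeasurable
    (Eventually.of_forall fun r hr e he =>
      hC (e, _, _) ⟨Metric.ball_subset_closedBall he, hmem r hr, sigma_mem hX (hmem r hr)⟩)
    intervalIntegrable_const
    (Eventually.of_forall fun r hr e _ => h _ (hmem r hr) _ e)).2

theorem exists_continuous_extension {E : Type*} [TopologicalSpace E] [NormalSpace E] {S : Set E}
    (hS : IsClosed S) {f : E → ℝ} (hf : ContinuousOn f S) :
    ∃ g : E → ℝ, Continuous g ∧ EqOn g f S := by
  obtain ⟨g, hg⟩ := ContinuousMap.exists_restrict_eq hS ⟨S.domRestrict f, hf.domRestrict⟩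
  exact ⟨g, g.continuous, fun x hx => congrArg (fun h : C(S, ℝ) => h ⟨x, hx⟩) hg⟩

theorem C1Diamond.continuousOn {X : Set ℝ} {b : ℝ} (hb : IsGreatest X b) {y : ℝ → ℝ}
    (hy : C1Diamond X y) : ContinuousOn y X := by
  intro t ht
  by_cases htκ : t ∈ kappaUp X
  · obtain ⟨d, hd⟩ := hy.delta_exists t htκ
    exact hd.continuousWithinAt ht
  · have h1 : rho X b < t := not_le.1 fun h => htκ ((mem_kappaUp hb).2 ⟨ht, h⟩)
    -- The only point of `X` outside `X^κ` is a left-scattered maximum, which is isolated in `X`.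
    have h2 : t = b := le_antisymm (hb.2 ht) (ge_of_rho_lt ht h1)
    subst h2
    rw [Metric.continuousWithinAt_iff]
    refine fun ε hε => ⟨t - rho X t, by linarith, fun s hs hst => ?_⟩
    rw [Real.dist_eq, abs_lt] at hst
    have : s = t := le_antisymm (hb.2 hs) (ge_of_rho_lt hs (by linarith))
    simpa [this] using hε

theorem supNorm_le {X : Set ℝ} {f : ℝ → ℝ} {C : ℝ} (hC : 0 ≤ C)
    (h : ∀ t ∈ kappaUp X, t ∈ kappaDown X → |f t| ≤ C) : supNorm X f ≤ C :=
  Real.iSup_le (fun t => h t t.2.1 t.2.2) hC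

theorem IsTestFunction.exists_norm1_le {X : Set ℝ} {a b : ℝ} (hX : IsClosed X) (ha : IsLeast X a)
    (hb : IsGreatest X b) (hab : a < b) {k : ℝ → ℝ} (hk : IsTestFunction X k) :
    ∃ C, 0 ≤ C ∧ ∀ e : ℝ, norm1 X (fun t => e * primitive X a k t) ≤ |e| * C := by
  have hkr := isRegular_of_continuous hX ha hb hk.cont
  obtain ⟨C, hC0, hC⟩ := hkr.bounded
  obtain ⟨D, hD0, hD⟩ := (isRegular_primitive hX ha hb hkr).bounded
  refine ⟨D + D + C + C, by positivity, fun e => ?_⟩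
  have hX' : ∀ t ∈ kappaUp X, t ∈ X := fun t ht => ((mem_kappaUp hb).1 ht).1
  have hmul : ∀ {x c : ℝ}, |x| ≤ c → |e * x| ≤ |e| * c := fun h => by
    rw [abs_mul]; exact mul_le_mul_of_nonneg_left h (abs_nonneg _)
  rw [norm1, mul_add, mul_add, mul_add]
  refine add_le_add (add_le_add (add_le_add ?_ ?_) ?_) ?_ <;>
    refine supNorm_le (by positivity) fun t ht ht' => ?_
  · exact hmul (hD _ (sigma_mem hX (hX' t ht)))
  · exact hmul (hD _ (rho_mem hX (hX' t ht)))
  · rw [((hasDeltaDeriv_primitive hX ha hb hkr ht).const_mul e).deltaDeriv_eq ha hb hab]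
    exact hmul (hC t (hX' t ht))
  · rw [((hk.hasNablaDeriv_primitive hX ha hb ht').const_mul e).nablaDeriv_eq ha hb hab]
    exact hmul (hC _ (rho_mem hX (hX' t ht)))

/-- Weak local minimality for the delta functional with integrand `M t (z (σ t)) (z^Δ t)` and
fixed boundary values. -/
def IsDeltaMin (X : Set ℝ) (M : ℝ → ℝ → ℝ → ℝ) (y : ℝ → ℝ) : Prop :=
  ∃ δ > 0, ∀ z, C1Diamond X z → z (sInf X) = y (sInf X) → z (sSup X) = y (sSup X) →
    norm1 X (fun t => z t - y t) < δ →
    deltaIntegral X (fun t => M t (y (sigma X t)) (deltaDeriv X y t)) ≤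
      deltaIntegral X (fun t => M t (z (sigma X t)) (deltaDeriv X z t))

/-- The value at `b` has measure zero. This makes harmless the default values of `dirDeriv` at `b`
for `u > 0` and of `deltaDeriv` at a left-scattered `b`. -/
theorem deltaIntegral_congr {X : Set ℝ} {a b : ℝ} (hX : IsClosed X) (ha : IsLeast X a)
    (hb : IsGreatest X b) {f g : ℝ → ℝ} (h : ∀ t ∈ X, t < b → f t = g t) :
    deltaIntegral X f = ∫ r in a..b, g (floor X r) := by
  have hab : a ≤ b := ha.2 hb.1
  rw [deltaIntegral, ha.csInf_eq, hb.csSup_eq]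
  refine intervalIntegral.integral_congr_ae ?_
  filter_upwards [compl_mem_ae_iff.2 (measure_singleton b)] with r hrb hr
  rw [uIoc_of_le hab] at hr
  exact h _ (floor_mem hX ha hr.1.le)
    ((floor_le ha hr.1.le).trans_lt (lt_of_le_of_ne hr.2 hrb))

/-- The integrated delta Euler-Lagrange equation. -/
theorem IsDeltaMin.exists_const {X : Set ℝ} {a b : ℝ} (hX : IsClosed X) (ha : IsLeast X a)
    (hb : IsGreatest X b) (hab : a < b) {M : ℝ → ℝ → ℝ → ℝ} (hM : SmoothLagrangian X M)
    {y : ℝ → ℝ} (hy : C1Diamond X y) (hmin : IsDeltaMin X M y) :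
    ∃ c p, IsRegular X p ∧
      (∀ t ∈ kappaUp X, p t = partial2 M t (y (sigma X t)) (deltaDeriv X y t)) ∧
      ∀ t ∈ kappaUp X, partial3 M t (y (sigma X t)) (deltaDeriv X y t) =
        c + primitive X a p t := by
  -- Tietze extensions of `y`, `y^Δ`, the Lagrangian and its partial derivatives make the integrands
  -- globally continuous. The extended functions `M₂`, `M₃` are derivatives of `M₀` only over `X`,
  -- which suffices.
  obtain ⟨Y, hYc, hY⟩ := exists_continuous_extension hX (hy.continuousOn hb)
  obtain ⟨D, hDc, hD⟩ := exists_continuous_extension (isClosed_kappaUp hX hb) hy.delta_cont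
  have hXu : IsClosed (X ×ˢ (univ : Set (ℝ × ℝ))) := hX.prod isClosed_univ
  obtain ⟨M₀, hM₀c, hM₀⟩ := exists_continuous_extension hXu hM.cont
  obtain ⟨M₂, hM₂c, hM₂⟩ := exists_continuous_extension hXu hM.cont2
  obtain ⟨M₃, hM₃c, hM₃⟩ := exists_continuous_extension hXu hM.cont3
  have hXκ : ∀ t ∈ kappaUp X, t ∈ X := fun t ht => ((mem_kappaUp hb).1 ht).1
  have hp : IsRegular X fun t => M₂ (t, Y (sigma X t), D t) :=
    isRegular_sigma hX ha hb (q := fun x => M₂ (x.1, Y x.2, D x.1)) (by fun_prop)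
  have hf : IsRegular X fun t => M₃ (t, Y (sigma X t), D t) :=
    isRegular_sigma hX ha hb (q := fun x => M₃ (x.1, Y x.2, D x.1)) (by fun_prop)
  obtain ⟨c, hc⟩ := duBoisReymond hX ha hb hab hf hp (by
    intro k hk hk0
    have hkr := isRegular_of_continuous hX ha hb hk.cont
    set η := primitive X a k with hη
    have hηc : Continuous η := continuous_primitive hX ha hkr
    have hηΔ := fun t (ht : t ∈ kappaUp X) => hasDeltaDeriv_primitive hX ha hb hkr ht
    set Φ : ℝ × ℝ × ℝ → ℝ := fun q =>
      M₀ (q.2.1, Y q.2.2 + q.1 * η q.2.2, D q.2.1 + q.1 * k q.2.1) with hΦ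
    set Φ' : ℝ × ℝ × ℝ → ℝ := fun q =>
      M₂ (q.2.1, Y q.2.2 + q.1 * η q.2.2, D q.2.1 + q.1 * k q.2.1) * η q.2.2 +
      M₃ (q.2.1, Y q.2.2 + q.1 * η q.2.2, D q.2.1 + q.1 * k q.2.1) * k q.2.1 with hΦ'
    have hkc := hk.cont
    have hder := hasDerivAt_integral_floor hX ha hb (Φ := Φ) (Φ' := Φ') (by fun_prop) (by fun_prop)
      (fun t ht s e => by
        have := hM.hasDerivAt_line ht (Y s) (D t) (η s) (k t) e
        simp only [hΦ, hΦ']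
        rw [hM₂ ⟨ht, mem_univ _⟩, hM₃ ⟨ht, mem_univ _⟩]
        refine this.congr_of_eventuallyEq (Eventually.of_forall fun e => ?_)
        exact hM₀ ⟨ht, mem_univ _⟩)
    have hval : ∀ e, deltaIntegral X (fun t => M t (y (sigma X t) + e * η (sigma X t))
        (deltaDeriv X (fun t => y t + e * η t) t)) =
        ∫ r in a..b, Φ (e, floor X r, sigma X (floor X r)) := fun e => by
      refine deltaIntegral_congr hX ha hb (g := fun t => Φ (e, t, sigma X t)) fun t ht htb => ?_
      have htκ := mem_kappaUp_of_lt hb ht htb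
      obtain ⟨d, hd⟩ := hy.delta_exists t htκ
      rw [(hd.add_const_mul (hηΔ t htκ) e).deltaDeriv_eq ha hb hab, hΦ]
      have h2 : D t = d := by rw [hD htκ, hd.deltaDeriv_eq ha hb hab]
      have h3 := hM₀ (x := (t, Y (sigma X t) + e * η (sigma X t), D t + e * k t)) ⟨ht, mem_univ _⟩
      simp only at h3 ⊢
      rw [h3, hY (sigma_mem hX ht), h2]
    obtain ⟨δ, hδ, hmin⟩ := hmin
    obtain ⟨C, hC0, hC⟩ := hk.exists_norm1_le hX ha hb hab
    have hloc : IsLocalMin (fun e => ∫ r in a..b, Φ (e, floor X r, sigma X (floor X r))) 0 := by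
      have hsmall : ∀ᶠ e : ℝ in 𝓝 0, |e| * C < δ := by
        have : ContinuousAt (fun e : ℝ => |e| * C) 0 := by fun_prop
        exact this.eventually_lt continuousAt_const (by simpa using hδ)
      filter_upwards [hsmall] with e he
      rw [← hval, ← hval]
      have hη0 : η a = 0 := by simp [hη, primitive]
      -- The constraint `∫ k = 0` is exactly what preserves the boundary value at `b`.
      have hηb : η b = 0 := hk0
      have := hmin (fun t => y t + e * η t)
        (hy.add_const_mul ha hb hab (hk.c1Diamond_primitive hX ha hb hab) e)
        (by rw [ha.csInf_eq, hη0]; ring) (by rw [hb.csSup_eq, hηb]; ring)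
        (by simp only [add_sub_cancel_left]; exact (hC e).trans_lt he)
      simpa using this
    have h0 := hloc.hasDerivAt_eq_zero hder
    simpa [hΦ'] using h0)
  refine ⟨c, _, hp, fun t ht => ?_, fun t ht => ?_⟩
  · rw [hY (sigma_mem hX (hXκ t ht)), hD ht]
    exact hM₂ (x := (t, y (sigma X t), deltaDeriv X y t)) ⟨hXκ t ht, mem_univ _⟩
  · rw [← hc t ht, hY (sigma_mem hX (hXκ t ht)), hD ht]
    exact (hM₃ (x := (t, y (sigma X t), deltaDeriv X y t)) ⟨hXκ t ht, mem_univ _⟩).symm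

/-- The delta Euler-Lagrange equation. -/
theorem IsDeltaMin.hasDeltaDeriv {X : Set ℝ} {a b : ℝ} (hX : IsClosed X) (ha : IsLeast X a)
    (hb : IsGreatest X b) (hab : a < b) {M : ℝ → ℝ → ℝ → ℝ} (hM : SmoothLagrangian X M)
    {y : ℝ → ℝ} (hy : C1Diamond X y) (hmin : IsDeltaMin X M y) {t : ℝ}
    (ht : t ∈ kappaUp (kappaUp X)) (htb : sigma X t < b ∨ t = b) :
    HasDeltaDeriv (kappaUp X) (fun s => partial3 M s (y (sigma X s)) (deltaDeriv X y s)) t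
      (partial2 M t (y (sigma X t)) (deltaDeriv X y t)) := by
  obtain ⟨c, p, hp, hp₂, hF⟩ := hmin.exists_const hX ha hb hab hM hy
  have htκ := ((mem_kappaUp (isGreatest_kappaUp hX hb)).1 ht).1
  -- Since `X^κ` and `X` have the same jump at `t`, the estimate for the primitive on `X` restricts
  -- to `X^κ`, where `F = c + P` is known.
  have hσ := sigma_kappaUp hX hb htκ htb
  have hG := hasDeltaDeriv_primitive hX ha hb hp htκ
  have hσκ := sigma_mem (isClosed_kappaUp hX hb) htκ
  rw [← hp₂ t htκ]
  refine ⟨ht, fun ε hε => ?_⟩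
  obtain ⟨δ, hδ, H⟩ := hG.2 ε hε
  refine ⟨δ, hδ, fun s hs hst => ?_⟩
  have := H s ((mem_kappaUp hb).1 hs).1 hst
  beta_reduce
  rw [hF _ hσκ, hF s hs, hσ, add_sub_add_left_eq_sub]
  exact this

/-! ### Directional derivatives of the affine extension -/

section dirDeriv

variable {X : Set ℝ} {a b t u d : ℝ} {f : ℝ → ℝ}

theorem ext_of_mem (ht : t ∈ X) : ext X f t = f t := if_pos ht

theorem sSup_inter_Iio {s : ℝ} (hs : s ∈ X) (hst : s < t) (ht : t ≤ sigma X s) :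
    sSup (X ∩ Iio t) = s :=
  IsGreatest.csSup_eq ⟨⟨hs, hst⟩, fun _ hx => le_of_lt_sigma hx.1 (lt_of_lt_of_le hx.2 ht)⟩

theorem ext_of_gap {s : ℝ} (hs : s ∈ X) (hst : s < t) (ht : t < sigma X s) :
    ext X f t = f s + (f (sigma X s) - f s) / (sigma X s - s) * (t - s) := by
  have htX : t ∉ X := fun h => absurd (sigma_le h hst) (not_le.2 ht)
  rw [ext, if_neg htX, sSup_inter_Iio hs hst ht.le]

theorem exists_gap (hX : IsClosed X) (ha : IsLeast X a) (hb : IsGreatest X b)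
    (ht : t ∈ Icc a b) (htX : t ∉ X) : ∃ s ∈ X, s < t ∧ t < sigma X s := by
  have h1 := floor_mem hX ha ht.1
  have h2 : floor X t < t := lt_of_le_of_ne (floor_le ha ht.1) fun h => htX (h ▸ h1)
  refine ⟨_, h1, h2, lt_of_le_of_ne (not_lt.1 fun h => ?_) fun h => htX (h ▸ sigma_mem hX h1)⟩
  exact lt_irrefl _ (lt_floor_of_sigma_lt hX hb h1 (h2.trans_le ht.2) h)

theorem HasDirDeriv.dirDeriv_eq (h : HasDirDeriv X f t u d) : dirDeriv X f t u = d := by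
  have h' : ∃ d, HasDirDeriv X f t u d := ⟨d, h⟩
  rw [dirDeriv, dif_pos h']
  exact tendsto_nhds_unique h'.choose_spec.2.2 h.2.2

/-- Inside a gap the extension is a convex combination of the values at the two ends, and the bound
`ε * (r - t)` is affine in `r`, so the estimate passes from the ends to `r`. -/
theorem HasDeltaDeriv.abs_ext_sub_le (hX : IsClosed X) (ha : IsLeast X a) (hb : IsGreatest X b)
    {ε z : ℝ} (ht : t ∈ X)
    (hz : z ∈ X) (H : ∀ s ∈ X, t ≤ s → s ≤ z → |f s - f t - d * (s - t)| ≤ ε * (s - t))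
    {r : ℝ} (htr : t < r) (hrz : r < z) :
    |ext X f r - f t - d * (r - t)| ≤ ε * (r - t) := by
  by_cases hr : r ∈ X
  · rw [ext_of_mem hr]
    exact H r hr htr.le hrz.le
  obtain ⟨s, hs, hsr, hrs⟩ := exists_gap hX ha hb
    ⟨(ha.2 ht).trans htr.le, hrz.le.trans (hb.2 hz)⟩ hr
  have hts : t ≤ s := by
    by_contra hc
    exact absurd (sigma_le ht (not_le.1 hc)) (not_le.2 (htr.trans hrs))
  have hqz : sigma X s ≤ z := sigma_le hz (hsr.trans hrz)
  rw [ext_of_gap hs hsr hrs]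
  set q := sigma X s with hq
  have hqs : 0 < q - s := by linarith
  have h1 := H s hs hts (hsr.trans hrz).le
  have h2 := H q (sigma_mem hX hs) (by linarith) hqz
  set w := (r - s) / (q - s) with hw
  have hw0 : 0 ≤ w := div_nonneg (by linarith) hqs.le
  have hw1 : 0 ≤ 1 - w := by
    rw [sub_nonneg, hw, div_le_one hqs]; linarith
  have hr' : r = (1 - w) * s + w * q := by
    rw [hw]; field_simp; ring
  have e1 : f s + (f q - f s) / (q - s) * (r - s) = (1 - w) * f s + w * f q := by
    rw [hw]; field_simp; ring
  have e2 : f s + (f q - f s) / (q - s) * (r - s) - f t - d * (r - t) =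
      (1 - w) * (f s - f t - d * (s - t)) + w * (f q - f t - d * (q - t)) := by
    rw [e1]; nth_rw 1 [hr']; ring
  rw [e2]
  refine (abs_add_le _ _).trans ?_
  rw [abs_mul, abs_mul, abs_of_nonneg hw0, abs_of_nonneg hw1]
  calc _ ≤ (1 - w) * (ε * (s - t)) + w * (ε * (q - t)) := by gcongr
    _ = ε * (((1 - w) * s + w * q) - t) := by ring
    _ = _ := by rw [← hr']

theorem HasDeltaDeriv.hasDirDeriv (hX : IsClosed X) (ha : IsLeast X a) (hb : IsGreatest X b)
    (h : HasDeltaDeriv X f t d) (htb : t < b) (hu : 0 < u) : HasDirDeriv X f t u (u * d) := by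
  have ht : t ∈ X := ((mem_kappaUp hb).1 h.1).1
  have hsmall : ∀ z, t < z → ∀ᶠ r in 𝓝[>] (0 : ℝ), 0 < r ∧ t < t + r * u ∧ t + r * u < z := by
    intro z hz
    have hpos : 0 < (z - t) / u := div_pos (sub_pos.2 hz) hu
    filter_upwards [Ioo_mem_nhdsGT hpos] with r hr
    have h1 := mul_pos hr.1 hu
    have h2 := (lt_div_iff₀ hu).1 hr.2
    exact ⟨hr.1, by linarith, by linarith⟩
  rw [HasDirDeriv, ha.csInf_eq, hb.csSup_eq]
  refine ⟨⟨ha.2 ht, htb.le⟩, ?_, ?_⟩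
  · filter_upwards [hsmall b htb] with r hr
    exact ⟨(ha.2 ht).trans hr.2.1.le, hr.2.2.le⟩
  rw [ext_of_mem ht]
  rcases (le_sigma X t).eq_or_lt with hσ | hlt
  · rw [Metric.tendsto_nhds]
    intro ε hε
    obtain ⟨δ, hδ, H⟩ := h.2 (ε / (2 * u)) (by positivity)
    -- Staying below a point `z` of `X` keeps both ends of any gap that is met inside the
    -- `δ`-neighbourhood.
    obtain ⟨z, hz, htz, hzδ⟩ := exists_lt_of_sigma_eq hb.1 htb hσ.symm (lt_add_of_pos_right t hδ)
    filter_upwards [hsmall z htz] with r ⟨hr0, hr1, hr2⟩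
    have := HasDeltaDeriv.abs_ext_sub_le (f := f) (d := d) (ε := ε / (2 * u)) hX ha hb ht
      hz (fun s hs hts hsz => by
        have := H s hs (abs_lt.2 ⟨by linarith, by linarith⟩)
        rw [← hσ, ← abs_neg, ← abs_neg (t - s), neg_sub t s, abs_of_nonneg (sub_nonneg.2 hts)] at this
        convert this using 2
        ring) hr1 hr2
    rw [Real.dist_eq]
    have e : (ext X f (t + r * u) - f t) / r - u * d =
        (ext X f (t + r * u) - f t - d * (t + r * u - t)) / r := by
      field_simp; ring
    rw [e, abs_div, abs_of_pos hr0, div_lt_iff₀ hr0]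
    refine this.trans_lt ?_
    have : ε / (2 * u) * (t + r * u - t) = ε / 2 * r := by field_simp; ring
    rw [this]
    gcongr
    linarith
  · have hμ : 0 < sigma X t - t := by linarith
    have hslope : (f (sigma X t) - f t) / (sigma X t - t) = d := by
      rw [div_eq_iff hμ.ne', ← sub_eq_zero, ← abs_eq_zero]
      refine le_antisymm (le_of_forall_pos_le_add fun ε hε => ?_) (abs_nonneg _)
      -- At a right-scattered point the defining inequality with `s = t`, valid for every `ε`,
      -- forces `d` to be the slope of the gap.
      obtain ⟨δ, hδ, H⟩ := h.2 (ε / (sigma X t - t)) (by positivity)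
      have := H t ht (by simpa using hδ)
      rw [abs_of_pos hμ, div_mul_cancel₀ _ hμ.ne'] at this
      simpa using this
    refine tendsto_const_nhds.congr' ?_
    filter_upwards [hsmall _ hlt] with r ⟨hr0, hr1, hr2⟩
    rw [ext_of_gap ht hr1 hr2, hslope]
    field_simp; ring

/-- The gap `(s, σ s)` reflects to `(-σ s, -s)`, so the interpolation now starts from the other end;
both describe the same affine function. -/
theorem ext_neg (hX : IsClosed X) (ha : IsLeast X a) (hb : IsGreatest X b) (ht : t ∈ Icc a b) :
    ext (-X) (fun s => -f (-s)) (-t) = -ext X f t := by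
  by_cases htX : t ∈ X
  · rw [ext_of_mem htX, ext_of_mem (by simpa using htX), neg_neg]
  obtain ⟨s, hs, hst, hts⟩ := exists_gap hX ha hb ht htX
  have hσ : sigma (-X) (-sigma X s) = -s := by
    have := sigma_rho (X := -X) (t := -s) (by simpa using hs) (by rw [rho_neg]; linarith)
    rwa [rho_neg] at this
  rw [ext_of_gap hs hst hts, ext_of_gap (X := -X) (s := -sigma X s)
    (by simpa using sigma_mem hX hs) (by linarith) (by rw [hσ]; linarith), hσ]
  have h1 : sigma X s - s ≠ 0 := by linarith
  have h2 : -s - -sigma X s ≠ 0 := by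
    intro h; exact h1 (by linarith)
  simp only [neg_neg]
  have h3 : -s - -sigma X s = sigma X s - s := by ring
  rw [h3]
  field_simp
  ring

theorem HasDirDeriv.of_neg (hX : IsClosed X) (ha : IsLeast X a) (hb : IsGreatest X b)
    (h : HasDirDeriv (-X) (fun s => -f (-s)) (-t) (-u) (-d)) : HasDirDeriv X f t u d := by
  rw [HasDirDeriv, (isLeast_neg hb).csInf_eq, (isGreatest_neg ha).csSup_eq] at h
  rw [HasDirDeriv, ha.csInf_eq, hb.csSup_eq]
  obtain ⟨h1, h2, h3⟩ := h
  have ht : t ∈ Icc a b := ⟨by linarith [h1.2], by linarith [h1.1]⟩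
  have h2' : ∀ᶠ r in 𝓝[>] (0 : ℝ), t + r * u ∈ Icc a b := by
    filter_upwards [h2] with r hr
    exact ⟨by linarith [hr.2], by linarith [hr.1]⟩
  refine ⟨ht, h2', ?_⟩
  have h4 := h3.neg
  rw [neg_neg] at h4
  refine h4.congr' ?_
  filter_upwards [h2'] with r hr
  have e : -t + r * -u = -(t + r * u) := by ring
  rw [e, ext_neg hX ha hb hr, ext_neg hX ha hb ht]
  ring

theorem HasNablaDeriv.hasDirDeriv (hX : IsClosed X) (ha : IsLeast X a) (hb : IsGreatest X b)
    (h : HasNablaDeriv X f t d) (hat : a < t) (hu : u < 0) : HasDirDeriv X f t u (u * d) := by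
  refine HasDirDeriv.of_neg hX ha hb ?_
  rw [← neg_mul]
  exact (hasDeltaDeriv_neg_iff.2 h).hasDirDeriv hX.neg (isLeast_neg hb) (isGreatest_neg ha)
    (neg_lt_neg hat) (neg_pos.2 hu)

theorem C1Diamond.dirDeriv_of_pos (hX : IsClosed X) (ha : IsLeast X a) (hb : IsGreatest X b)
    (hf : C1Diamond X f) (hu : 0 < u) (ht : t ∈ X) (htb : t < b) :
    dirDeriv X f t u = u * deltaDeriv X f t := by
  obtain ⟨d, hd⟩ := hf.delta_exists t (mem_kappaUp_of_lt hb ht htb)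
  rw [(hd.hasDirDeriv hX ha hb htb hu).dirDeriv_eq,
    hd.deltaDeriv_eq ha hb ((ha.2 ht).trans_lt htb)]

theorem mem_kappaDown_of_lt (ha : IsLeast X a) (ht : t ∈ X) (h : a < t) : t ∈ kappaDown X :=
  (mem_kappaDown ha).2 ⟨ht, sigma_le ht h⟩

theorem C1Diamond.dirDeriv_of_neg (hX : IsClosed X) (ha : IsLeast X a) (hb : IsGreatest X b)
    (hf : C1Diamond X f) (hu : u < 0) (ht : t ∈ X) (hat : a < t) :
    dirDeriv X f t u = u * nablaDeriv X f t := by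
  obtain ⟨d, hd⟩ := hf.nabla_exists t (mem_kappaDown_of_lt ha ht hat)
  rw [(hd.hasDirDeriv hX ha hb hat hu).dirDeriv_eq,
    hd.nablaDeriv_eq ha hb (hat.trans_le (hb.2 ht))]

end dirDeriv

/-! ### The Euler-Lagrange equations -/

theorem HasNablaDeriv.congr {X : Set ℝ} {t d : ℝ} {f g : ℝ → ℝ} (h : HasNablaDeriv X f t d)
    (hρ : g (rho X t) = f (rho X t)) {r : ℝ} (hr : 0 < r)
    (hfg : ∀ s ∈ X, |s - t| < r → g s = f s) : HasNablaDeriv X g t d := by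
  refine ⟨h.1, fun ε hε => ?_⟩
  obtain ⟨δ, hδ, H⟩ := h.2 ε hε
  refine ⟨min δ r, lt_min hδ hr, fun s hs hst => ?_⟩
  rw [hρ, hfg s hs (hst.trans_le (min_le_right _ _))]
  exact H s hs (hst.trans_le (min_le_left _ _))

/-- The parameters `(c, w, w', r)` are `(u, u, u, 1)` for `u > 0` and `(u, -u, u, -1)` for `u < 0`.
The sign of `w` undoes that of the reflected function, and the factor `c = u` is kept so that
minimality is not reversed. -/
theorem partial2_scale (L : ℝ → ℝ → ℝ → ℝ) (c w w' r t x v : ℝ) :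
    partial2 (fun t x v => c * L (r * t) (w * x) (w' * v)) t x v =
      c * w * partial2 L (r * t) (w * x) (w' * v) := by
  unfold partial2
  rw [deriv_const_mul_field, deriv_comp_mul_left w (fun z => L (r * t) z (w' * v)) x, smul_eq_mul,
    mul_assoc]

theorem partial3_scale (L : ℝ → ℝ → ℝ → ℝ) (c w w' r t x v : ℝ) :
    partial3 (fun t x v => c * L (r * t) (w * x) (w' * v)) t x v =
      c * w' * partial3 L (r * t) (w * x) (w' * v) := by
  unfold partial3
  rw [deriv_const_mul_field, deriv_comp_mul_left w' (fun z => L (r * t) (w * x) z) v, smul_eq_mul,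
    mul_assoc]

theorem SmoothLagrangian.scale {X Y : Set ℝ} {L : ℝ → ℝ → ℝ → ℝ} (hL : SmoothLagrangian X L)
    (c w w' r : ℝ) (hr : ∀ t ∈ Y, r * t ∈ X) :
    SmoothLagrangian Y (fun t x v => c * L (r * t) (w * x) (w' * v)) := by
  have hmap : ContinuousOn (fun p : ℝ × ℝ × ℝ => (r * p.1, w * p.2.1, w' * p.2.2))
    (Y ×ˢ univ) := by fun_prop
  have hmem : MapsTo (fun p : ℝ × ℝ × ℝ => (r * p.1, w * p.2.1, w' * p.2.2))
    (Y ×ˢ univ) (X ×ˢ univ) := fun p hp => ⟨hr _ hp.1, mem_univ _⟩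
  refine ⟨(hL.cont.comp hmap hmem).const_smul c, fun t ht x v => ?_, fun t ht x v => ?_, ?_, ?_⟩
  · exact ((hL.diff2 _ (hr t ht) _ _).comp x (differentiableAt_id.const_mul w)).const_mul c
  · exact ((hL.diff3 _ (hr t ht) _ _).comp v (differentiableAt_id.const_mul w')).const_mul c
  · simp only [partial2_scale]
    exact (hL.cont2.comp hmap hmem).const_smul (c * w)
  · simp only [partial3_scale]
    exact (hL.cont3.comp hmap hmem).const_smul (c * w')

theorem nablaIntegral_eq (X : Set ℝ) (f : ℝ → ℝ) :
    nablaIntegral X f = deltaIntegral (-X) fun t => f (-t) := by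
  have h : ∀ t, -sSup (-X ∩ Iic t) = sInf (X ∩ Ici (-t)) := fun t => by
    rw [← Real.sInf_neg]
    congr 1
    ext x; simp
  unfold nablaIntegral deltaIntegral
  rw [Real.sInf_neg, Real.sSup_neg]
  simp only [h]
  rw [intervalIntegral.integral_comp_neg fun t => f (sInf (X ∩ Ici t)), neg_neg, neg_neg]

section functional

variable {T : Set ℝ} {a b u : ℝ} {L : ℝ → ℝ → ℝ → ℝ} {y : ℝ → ℝ}

theorem functional_of_pos (hT : IsClosed T) (ha : IsLeast T a) (hb : IsGreatest T b)
    (hu : 0 < u) (hy : C1Diamond T y) :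
    functional T L u y = deltaIntegral T
      fun t => u * L (1 * t) (u * y (sigma T t)) (u * deltaDeriv T y t) := by
  rw [deltaIntegral_congr hT ha hb fun _ _ _ => rfl, intervalIntegral.integral_const_mul,
    functional, dirIntegral, if_pos hu.le]
  congr 1
  refine deltaIntegral_congr hT ha hb
    (g := fun t => L (1 * t) (u * y (sigma T t)) (u * deltaDeriv T y t)) fun t ht htb => ?_
  rw [hy.dirDeriv_of_pos hT ha hb hu ht htb, xiComp, if_pos hu.le, one_mul]

theorem functional_of_neg (hT : IsClosed T) (ha : IsLeast T a) (hb : IsGreatest T b)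
    (hu : u < 0) (hy : C1Diamond T y) :
    functional T L u y = deltaIntegral (-T) fun t => u * L (-1 * t)
      (-u * -y (-sigma (-T) t)) (u * deltaDeriv (-T) (fun s => -y (-s)) t) := by
  have hX := hT.neg
  rw [deltaIntegral_congr hX (isLeast_neg hb) (isGreatest_neg ha) fun _ _ _ => rfl,
    intervalIntegral.integral_const_mul, functional, dirIntegral, if_neg (not_le.2 hu),
    nablaIntegral_eq]
  congr 1
  refine deltaIntegral_congr hX (isLeast_neg hb) (isGreatest_neg ha) (g := fun t => L (-1 * t)
      (-u * -y (-sigma (-T) t)) (u * deltaDeriv (-T) (fun s => -y (-s)) t)) fun t ht htb => ?_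
  have h1 : deltaDeriv (-T) (fun s => -y (-s)) t = nablaDeriv T y (-t) := by
    rw [← deltaDeriv_neg, neg_neg]
  rw [hy.dirDeriv_of_neg hT ha hb hu ht (by linarith), xiComp, if_neg (not_le.2 hu), h1,
    rho_eq T (-t), neg_neg, neg_one_mul, neg_mul_neg]

theorem IsWeakLocalMin.isDeltaMin_of_pos {α β : ℝ} (hT : IsClosed T) (ha : IsLeast T a)
    (hb : IsGreatest T b) (hu : 0 < u) (hy : IsWeakLocalMin T L u α β y) :
    IsDeltaMin T (fun t x v => u * L (1 * t) (u * x) (u * v)) y := by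
  obtain ⟨⟨hy1, hya, hyb⟩, δ, hδ, H⟩ := hy
  refine ⟨δ, hδ, fun z hz hza hzb hzy => ?_⟩
  have := H z ⟨hz, hza.trans hya, hzb.trans hyb⟩ hzy
  rwa [functional_of_pos hT ha hb hu hy1, functional_of_pos hT ha hb hu hz] at this

theorem IsWeakLocalMin.isDeltaMin_of_neg {α β : ℝ} (hT : IsClosed T) (ha : IsLeast T a)
    (hb : IsGreatest T b) (hu : u < 0) (hy : IsWeakLocalMin T L u α β y) :
    IsDeltaMin (-T) (fun t x v => u * L (-1 * t) (-u * x) (u * v)) (fun s => -y (-s)) := by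
  obtain ⟨⟨hy1, hya, hyb⟩, δ, hδ, H⟩ := hy
  refine ⟨δ, hδ, fun z hz hza hzb hzy => ?_⟩
  have hz' : C1Diamond T fun s => -z (-s) := by simpa using hz.neg
  rw [Real.sInf_neg] at hza
  rw [Real.sSup_neg] at hzb
  simp only [neg_neg] at hza hzb
  have hn : norm1 T (fun t => -z (-t) - y t) < δ := by
    rw [← norm1_neg]
    convert hzy using 2
    funext t; simp only [neg_neg]; ring
  have := H _ ⟨hz', by rw [hzb, neg_neg, hya], by rw [hza, neg_neg, hyb]⟩ hn
  rw [functional_of_neg hT ha hb hu hy1, functional_of_neg hT ha hb hu hz'] at this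
  simpa using this

/-- The delta Euler-Lagrange equation of a weak local minimizer in a positive direction. -/
theorem IsWeakLocalMin.hasDeltaDeriv {α β t : ℝ} (hT : IsClosed T) (ha : IsLeast T a)
    (hb : IsGreatest T b) (hab : a < b) (hL : SmoothLagrangian T L) (hu : 0 < u)
    (hy : IsWeakLocalMin T L u α β y) (ht : t ∈ kappaUp (kappaUp T))
    (htb : sigma T t < b ∨ t = b) :
    HasDeltaDeriv (kappaUp T)
      (fun s => partial3 L s (u * y (sigma T s)) (u * deltaDeriv T y s)) t
      (partial2 L t (u * y (sigma T t)) (u * deltaDeriv T y t)) := by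
  -- Both partial derivatives of the scaled Lagrangian carry the factor `u * u`, which is divided
  -- out.
  have h := ((hy.isDeltaMin_of_pos hT ha hb hu).hasDeltaDeriv hT ha hb hab
    (hL.scale u u u 1 (by simp)) hy.1.1 ht htb).const_mul (u * u)⁻¹
  simp only [partial2_scale, partial3_scale] at h
  simp only [one_mul] at h
  have hu2 : u * u ≠ 0 := (mul_pos hu hu).ne'
  simpa only [inv_mul_cancel_left₀ hu2] using h

/-- The nabla Euler-Lagrange equation of a weak local minimizer in a negative direction. -/
theorem IsWeakLocalMin.hasNablaDeriv {α β t : ℝ} (hT : IsClosed T) (ha : IsLeast T a)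
    (hb : IsGreatest T b) (hab : a < b) (hL : SmoothLagrangian T L) (hu : u < 0)
    (hy : IsWeakLocalMin T L u α β y) (ht : t ∈ kappaDown (kappaDown T))
    (hat : a < rho T t ∨ t = a) :
    HasNablaDeriv (kappaDown T)
      (fun s => partial3 L s (u * y (rho T s)) (u * nablaDeriv T y s)) t
      (partial2 L t (u * y (rho T t)) (u * nablaDeriv T y t)) := by
  -- Here `∂₃` carries `u * u` and `∂₂` carries `-(u * u)`. Multiplication by `-(u * u)⁻¹` produces
  -- exactly the reflected function `-F(-s)` with derivative `∂₂L`.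
  have h := ((hy.isDeltaMin_of_neg hT ha hb hu).hasDeltaDeriv (t := -t) hT.neg (isLeast_neg hb)
    (isGreatest_neg ha) (neg_lt_neg hab) (hL.scale u (-u) u (-1) (by simp)) hy.1.1.neg
    (by rw [kappaUp_neg, kappaUp_neg]; simpa using ht)
    (by rw [sigma_neg]; exact hat.imp neg_lt_neg fun h => by rw [h])).const_mul (-(u * u)⁻¹)
  have h1 : ∀ s, deltaDeriv (-T) (fun s => -y (-s)) s = nablaDeriv T y (-s) := fun s => by
    rw [← deltaDeriv_neg, neg_neg]
  have h2 : ∀ s, -sigma (-T) s = rho T (-s) := fun s => by rw [rho_eq, neg_neg]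
  have hu2 : u * u ≠ 0 := (mul_pos_of_neg_of_neg hu hu).ne'
  have h3 : ∀ x, -(u * u)⁻¹ * (u * u * x) = -x := fun x => by
    rw [neg_mul, inv_mul_cancel_left₀ hu2]
  have h4 : ∀ x, -(u * u)⁻¹ * (u * -u * x) = x := fun x => by
    rw [mul_neg, neg_mul (u * u), neg_mul_neg, inv_mul_cancel_left₀ hu2]
  simp only [partial2_scale, partial3_scale] at h
  simp only [kappaUp_neg, h1, h2, neg_one_mul, neg_mul_neg,
    h3, h4, neg_neg, one_mul] at h
  exact hasDeltaDeriv_neg_iff.1 h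

theorem IsWeakLocalMin.hasDirDeriv_of_pos {α β t : ℝ} (hT : IsClosed T) (ha : IsLeast T a)
    (hb : IsGreatest T b) (hab : a < b) (hL : SmoothLagrangian T L) (hu : 0 < u)
    (hy : IsWeakLocalMin T L u α β y) (ht : t ∈ kappaUp (kappaUp T)) (htb : sigma T t < b) :
    HasDirDeriv (kappaUp T)
      (fun s => partial3 L s (xiComp T u y s) (dirDeriv T y s u)) t u
      (u * partial2 L t (xiComp T u y t) (dirDeriv T y t u)) := by
  have hκ := isGreatest_kappaUp hT hb
  have htκ := ((mem_kappaUp hκ).1 ht).1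
  have htT := ((mem_kappaUp hb).1 htκ).1
  have htb' : t < b := (le_sigma T t).trans_lt htb
  have hdir : ∀ s ∈ T, s < b → dirDeriv T y s u = u * deltaDeriv T y s := fun s hs hsb =>
    hy.1.1.dirDeriv_of_pos hT ha hb hu hs hsb
  have hxi : ∀ s, xiComp T u y s = u * y (sigma T s) := fun s => if_pos hu.le
  -- A point of `T` strictly between `t` and `b` gives `t < ρ b = max T^κ`, so direction `u` stays
  -- in the domain of `F̄`. The radius `b - t` used below excludes `b`, where `dirDeriv` takes its
  -- default value.
  obtain ⟨z, hz, htz, hzb⟩ := exists_lt_of_sigma_lt ⟨b, hb.1, htb'⟩ htb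
  rw [hdir t htT htb', hxi]
  refine HasDeltaDeriv.hasDirDeriv (isClosed_kappaUp hT hb) (isLeast_kappaUp ha hb hab) hκ
    ((hy.hasDeltaDeriv hT ha hb hab hL hu ht (Or.inl htb)).congr ?_ (sub_pos.2 htb')
      fun s hs hst => ?_) (htz.trans_le (le_rho hz hzb)) hu
  · rw [sigma_kappaUp hT hb htκ (Or.inl htb), hdir _ (sigma_mem hT htT) htb, hxi]
  · rw [hdir s ((mem_kappaUp hb).1 hs).1 (by linarith [(abs_lt.1 hst).2]), hxi]

theorem IsWeakLocalMin.hasDirDeriv_of_neg {α β t : ℝ} (hT : IsClosed T) (ha : IsLeast T a)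
    (hb : IsGreatest T b) (hab : a < b) (hL : SmoothLagrangian T L) (hu : u < 0)
    (hy : IsWeakLocalMin T L u α β y) (ht : t ∈ kappaDown (kappaDown T)) (hat : a < rho T t) :
    HasDirDeriv (kappaDown T)
      (fun s => partial3 L s (xiComp T u y s) (dirDeriv T y s u)) t u
      (u * partial2 L t (xiComp T u y t) (dirDeriv T y t u)) := by
  have hD : kappaDown T = -kappaUp (-T) := by rw [kappaUp_neg, neg_neg]
  have ha' := isGreatest_neg ha
  have hb' := isLeast_neg hb
  have hcl : IsClosed (kappaDown T) := hD ▸ (isClosed_kappaUp hT.neg ha').neg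
  have hleast : IsLeast (kappaDown T) (sigma T a) := by
    have := isLeast_neg (isGreatest_kappaUp hT.neg ha')
    rwa [rho_neg, neg_neg, ← hD] at this
  have hgreatest : IsGreatest (kappaDown T) b := by
    have := isGreatest_neg (isLeast_kappaUp hb' ha' (neg_lt_neg hab))
    rwa [neg_neg, ← hD] at this
  have htκ := ((mem_kappaDown hleast).1 ht).1
  have htT := ((mem_kappaDown ha).1 htκ).1
  have hat' : a < t := hat.trans_le (rho_le T t)
  have hρ : rho (kappaDown T) t = rho T t := by
    rw [rho_eq (kappaDown T), ← kappaUp_neg, sigma_kappaUp hT.neg ha'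
      (by rw [kappaUp_neg]; simpa using htκ) (Or.inl (by rw [sigma_neg]; linarith)), ← rho_eq]
  have hdir : ∀ s ∈ T, a < s → dirDeriv T y s u = u * nablaDeriv T y s := fun s hs has =>
    hy.1.1.dirDeriv_of_neg hT ha hb hu hs has
  have hxi : ∀ s, xiComp T u y s = u * y (rho T s) := fun s => if_neg (not_le.2 hu)
  -- The reflected form of a point of `T` strictly between `a` and `t`; it gives `σ a < t`, where `σ
  -- a = min T_κ`.
  obtain ⟨z, hz, htz, hzb⟩ := exists_lt_of_sigma_lt (X := -T) (t := -t) (z := -a)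
    ⟨-a, ha'.1, neg_lt_neg hat'⟩ (by rw [sigma_neg]; linarith)
  rw [hdir t htT hat', hxi]
  refine HasNablaDeriv.hasDirDeriv hcl hleast hgreatest
    ((hy.hasNablaDeriv hT ha hb hab hL hu ht (Or.inl hat)).congr ?_ (sub_pos.2 hat')
      fun s hs hst => ?_) (lt_of_le_of_lt (sigma_le hz (by linarith)) (by linarith)) hu
  · rw [hρ, hdir _ (rho_mem hT htT) hat, hxi]
  · rw [hdir s ((mem_kappaDown ha).1 hs).1 (by linarith [(abs_lt.1 hst).1]), hxi]

end functional

end TimeScale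

theorem theorem3 (T : Set ℝ) (a b : ℝ) (hT : IsClosed T) (ha : IsLeast T a)
    (hb : IsGreatest T b) (hab : (T ∩ Set.Ioo a b).Nonempty)
    (L : ℝ → ℝ → ℝ → ℝ) (hL : TimeScale.SmoothLagrangian T L)
    (u : ℝ) (hu : u ≠ 0) (α β : ℝ) (y : ℝ → ℝ)
    (hy : TimeScale.IsWeakLocalMin T L u α β y) :
    -- the directional equation, wherever direction `u` does not leave the domain
    (∀ t ∈ TimeScale.kappaUp (TimeScale.kappaUp T) ∩ TimeScale.kappaDown (TimeScale.kappaDown T),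
      (0 < u → TimeScale.sigma T t < b) → (u < 0 → a < TimeScale.rho T t) →
      TimeScale.HasDirDeriv (TimeScale.kappaDir T u)
        (fun s => TimeScale.partial3 L s (TimeScale.xiComp T u y s) (TimeScale.dirDeriv T y s u))
        t u
        (u * TimeScale.partial2 L t (TimeScale.xiComp T u y t) (TimeScale.dirDeriv T y t u))) ∧
    -- the delta equation
    (0 < u → ∀ t ∈ TimeScale.kappaUp (TimeScale.kappaUp T), (TimeScale.sigma T t < b ∨ t = b) →
      TimeScale.HasDeltaDeriv (TimeScale.kappaUp T)
        (fun s => TimeScale.partial3 L s (u * y (TimeScale.sigma T s))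
          (u * TimeScale.deltaDeriv T y s))
        t
        (TimeScale.partial2 L t (u * y (TimeScale.sigma T t)) (u * TimeScale.deltaDeriv T y t))) ∧
    -- the nabla equation
    (u < 0 → ∀ t ∈ TimeScale.kappaDown (TimeScale.kappaDown T),
      (a < TimeScale.rho T t ∨ t = a) →
      TimeScale.HasNablaDeriv (TimeScale.kappaDown T)
        (fun s => TimeScale.partial3 L s (u * y (TimeScale.rho T s))
          (u * TimeScale.nablaDeriv T y s))
        t
        (TimeScale.partial2 L t (u * y (TimeScale.rho T t))
          (u * TimeScale.nablaDeriv T y t))) := by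
  obtain ⟨c, -, hc⟩ := hab
  have hlt : a < b := hc.1.trans hc.2
  refine ⟨fun t ht h1 h2 => ?_, fun hu t ht htb => hy.hasDeltaDeriv hT ha hb hlt hL hu ht htb,
    fun hu t ht hat => hy.hasNablaDeriv hT ha hb hlt hL hu ht hat⟩
  rcases lt_or_gt_of_ne hu with hneg | hpos
  · rw [TimeScale.kappaDir, if_neg (not_le.2 hneg)]
    exact hy.hasDirDeriv_of_neg hT ha hb hlt hL hneg ht.2 (h2 hneg)
  · rw [TimeScale.kappaDir, if_pos hpos.le]
    exact hy.hasDirDeriv_of_pos hT ha hb hlt hL hpos ht.1 (h1 hpos)
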